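/- Let $d\ge 2$ and $1<p<q<\infty$. For a measurable function $b$ on $\mathbb{R}^d$ (real- or vector-valued) put $$\|b\|_{\dot E_{q,1}}:=\sup_{\rho>0}\ \rho\,\sup_{x\in\mathbb{R}^d}\Big(\frac1{|B_\rho(x)|}\int_{B_\rho(x)}|b(y)|^q\,dy\Big)^{1/q},\qquad B_\rho(x)=\{y:|y-x|<\rho\},$$ and write $b\in\dot E_{q,1}$ if this quantity is finite. There is a constant $N=N(d,p,q)<\infty$ such that the following hold. (i) For every real-valued $b\in\dot E_{q,1}$ and every real-valued $u\in C_0^\infty(\mathbb{R}^d)$, $$\|bu\|_{L_p}\le N\|b\|_{\dot E_{q,1}}\|Du\|_{L_p},\qquad \|b\,Du\|_{L_p}\le N\|b\|_{\dot E_{q,1}}\|D^2u\|_{L_p},$$ where $Du=(D_iu)$ and $D^2u=(D_iD_ju)$ carry the Euclidean norms and $L_p=L_p(\mathbb{R}^d)$. (ii) For every vector field $b=(b^1,\dots,b^d)\in\dot E_{q,1}$ the operator $u\mapsto \sum_i b^iD_iu$, with $D_i$ the weak derivatives, is a bounded linear operator from the Sobolev space $W^2_p(\mathbb{R}^d)$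 (functions in $L_p$ whose weak derivatives of first and second order are in $L_p$) to $L_p(\mathbb{R}^d)$, and $$\Big\|\sum_i b^iD_iu\Big\|_{L_p}\le N\|b\|_{\dot E_{q,1}}\|D^2u\|_{L_p}\qquad\text{for all }u\in W^2_p(\mathbb{R}^d).$$ -/

import Mathlib

open MeasureTheory
open scoped NNReal ContDiff

noncomputable section

/-- The Euclidean space `ℝ^d`. -/
abbrev Eucl (d : ℕ) : Type := EuclideanSpace ℝ (Fin d)

/-- Values of second derivatives: `d × d` matrices with the Euclidean (Frobenius) norm. -/
abbrev EuclMat (d : ℕ) : Type := EuclideanSpace ℝ (Fin d × Fin d)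

/-! ### Homogeneous Morrey spaces -/

/-- The averaged norm `(|B|⁻¹ ∫_B |f|^q dx)^(1/q)` over the ball `B = B_ρ(x)`. -/
def avgNorm {d : ℕ} {F : Type*} [NormedAddCommGroup F]
    (q : ENNReal) (f : Eucl d → F) (x : Eucl d) (ρ : ℝ) : ENNReal :=
  eLpNorm f q ((volume (Metric.ball x ρ))⁻¹ • volume.restrict (Metric.ball x ρ))

/-- The homogeneous Morrey norm `sup_{ρ > 0} ρ^β sup_{B ∈ 𝔹_ρ} (|B|⁻¹ ∫_B |f|^q dx)^(1/q)`,
with values in `[0, ∞]`. -/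
def morreyNorm {d : ℕ} {F : Type*} [NormedAddCommGroup F]
    (q : ENNReal) (β : ℝ) (f : Eucl d → F) : ENNReal :=
  ⨆ (ρ : ℝ) (_ : 0 < ρ), ENNReal.ofReal (ρ ^ β) * ⨆ x : Eucl d, avgNorm q f x ρ

/-- `f` belongs to the homogeneous Morrey space with exponents `q`, `β`. -/
def MemMorrey {d : ℕ} {F : Type*} [NormedAddCommGroup F]
    (q : ENNReal) (β : ℝ) (f : Eucl d → F) : Prop :=
  AEStronglyMeasurable f volume ∧ morreyNorm q β f < ⊤

/-! ### Classical derivatives -/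

/-- The classical partial derivative `D_i u`. -/
def partialD {d : ℕ} (i : Fin d) (u : Eucl d → ℝ) (x : Eucl d) : ℝ :=
  fderiv ℝ u x (EuclideanSpace.single i 1)

/-- The gradient `Du = (D_i u)`. -/
def gradD {d : ℕ} (u : Eucl d → ℝ) (x : Eucl d) : Eucl d :=
  WithLp.toLp 2 fun i => partialD i u x

/-- The matrix of second derivatives `D²u = (D_i D_j u)`. -/
def hessD {d : ℕ} (u : Eucl d → ℝ) (x : Eucl d) : EuclMat d :=
  WithLp.toLp 2 fun ij => partialD ij.1 (partialD ij.2 u) x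

/-! ### Weak derivatives and the Sobolev space `W²_p` -/

/-- `v` is the weak (Sobolev) partial derivative `D_i u` on `ℝ^d`. -/
def HasWeakPartial {d : ℕ} (i : Fin d) (u v : Eucl d → ℝ) : Prop :=
  LocallyIntegrable u volume ∧ LocallyIntegrable v volume ∧
    ∀ φ : Eucl d → ℝ, ContDiff ℝ ∞ φ → HasCompactSupport φ →
      ∫ x, partialD i φ x * u x = - ∫ x, φ x * v x

theorem partialD_continuous {d : ℕ} (i : Fin d) {φ : Eucl d → ℝ} (h : ContDiff ℝ ∞ φ) :
    Continuous (partialD i φ) :=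
  (h.continuous_fderiv (by simp)).clm_apply continuous_const

theorem partialD_hasCompactSupport {d : ℕ} (i : Fin d) {φ : Eucl d → ℝ}
    (h : HasCompactSupport φ) : HasCompactSupport (partialD i φ) :=
  h.fderiv_apply ℝ (EuclideanSpace.single i 1)

theorem HasWeakPartial.congr {d : ℕ} {i : Fin d} {u u' v v' : Eucl d → ℝ}
    (h : HasWeakPartial i u v) (hu : u =ᵐ[volume] u') (hv : v =ᵐ[volume] v') :
    HasWeakPartial i u' v' := by
  refine ⟨h.1.congr hu, h.2.1.congr hv, fun φ h1 h2 => ?_⟩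
  have e1 : ∫ x, partialD i φ x * u' x = ∫ x, partialD i φ x * u x :=
    integral_congr_ae (by filter_upwards [hu] with x hx; rw [hx])
  have e2 : ∫ x, φ x * v' x = ∫ x, φ x * v x :=
    integral_congr_ae (by filter_upwards [hv] with x hx; rw [hx])
  rw [e1, e2]
  exact h.2.2 φ h1 h2

theorem HasWeakPartial.zero {d : ℕ} (i : Fin d) :
    HasWeakPartial i (fun _ : Eucl d => (0 : ℝ)) (fun _ => 0) :=
  ⟨locallyIntegrable_zero, locallyIntegrable_zero, fun φ _ _ => by simp⟩

theorem HasWeakPartial.add {d : ℕ} {i : Fin d} {u u' v v' : Eucl d → ℝ}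
    (h : HasWeakPartial i u v) (h' : HasWeakPartial i u' v') :
    HasWeakPartial i (fun x => u x + u' x) (fun x => v x + v' x) := by
  refine ⟨h.1.add h'.1, h.2.1.add h'.2.1, fun φ h1 h2 => ?_⟩
  have c := partialD_continuous i h1
  have s := partialD_hasCompactSupport i h2
  have a1 := h.1.integrable_smul_left_of_hasCompactSupport c s
  have a2 := h'.1.integrable_smul_left_of_hasCompactSupport c s
  have b1 := h.2.1.integrable_smul_left_of_hasCompactSupport h1.continuous h2
  have b2 := h'.2.1.integrable_smul_left_of_hasCompactSupport h1.continuous h2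
  simp only [smul_eq_mul] at a1 a2 b1 b2
  simp only [mul_add]
  rw [integral_add a1 a2, integral_add b1 b2, h.2.2 φ h1 h2, h'.2.2 φ h1 h2]
  ring

theorem HasWeakPartial.smul {d : ℕ} {i : Fin d} {u v : Eucl d → ℝ} (c : ℝ)
    (h : HasWeakPartial i u v) :
    HasWeakPartial i (fun x => c * u x) (fun x => c * v x) := by
  refine ⟨h.1.smul c, h.2.1.smul c, fun φ h1 h2 => ?_⟩
  simp only [mul_left_comm _ c]
  rw [integral_const_mul, integral_const_mul, h.2.2 φ h1 h2]
  ring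

/-- The Sobolev space `W²_p`: the triples `(u, Du, D²u)` of `L_p` functions in which `Du` and
`D²u` are the weak first and second derivatives of `u` (these are determined by `u`).  It carries
the norm `max (‖u‖_p, ‖Du‖_p, ‖D²u‖_p)`, which is equivalent to the usual ones. -/
def SobolevW2 (d : ℕ) (p : ENNReal) [Fact (1 ≤ p)] :
    Submodule ℝ (Lp ℝ p (volume : Measure (Eucl d)) ×
      Lp (Eucl d) p (volume : Measure (Eucl d)) ×
      Lp (EuclMat d) p (volume : Measure (Eucl d))) where
  carrier := {U |
    (∀ i, HasWeakPartial i (fun x => U.1 x) (fun x => U.2.1 x i)) ∧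
    ∀ i j, HasWeakPartial i (fun x => U.2.1 x j) (fun x => U.2.2 x (i, j))}
  zero_mem' := by
    have h0 := Lp.coeFn_zero ℝ p (volume : Measure (Eucl d))
    have h1 := Lp.coeFn_zero (Eucl d) p (volume : Measure (Eucl d))
    have h2 := Lp.coeFn_zero (EuclMat d) p (volume : Measure (Eucl d))
    refine ⟨fun i => (HasWeakPartial.zero i).congr ?_ ?_,
      fun i j => (HasWeakPartial.zero i).congr ?_ ?_⟩
    · filter_upwards [h0] with x hx
      exact hx.symm
    · filter_upwards [h1] with x hx
      exact (congrArg (fun v : Eucl d => v i) hx).symm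
    · filter_upwards [h1] with x hx
      exact (congrArg (fun v : Eucl d => v j) hx).symm
    · filter_upwards [h2] with x hx
      exact (congrArg (fun v : EuclMat d => v (i, j)) hx).symm
  add_mem' := by
    intro U V hU hV
    have h0 := Lp.coeFn_add U.1 V.1
    have h1 := Lp.coeFn_add U.2.1 V.2.1
    have h2 := Lp.coeFn_add U.2.2 V.2.2
    refine ⟨fun i => ((hU.1 i).add (hV.1 i)).congr ?_ ?_,
      fun i j => ((hU.2 i j).add (hV.2 i j)).congr ?_ ?_⟩
    · filter_upwards [h0] with x hx
      exact hx.symm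
    · filter_upwards [h1] with x hx
      exact (congrArg (fun v : Eucl d => v i) hx).symm
    · filter_upwards [h1] with x hx
      exact (congrArg (fun v : Eucl d => v j) hx).symm
    · filter_upwards [h2] with x hx
      exact (congrArg (fun v : EuclMat d => v (i, j)) hx).symm
  smul_mem' := by
    intro c U hU
    have h0 := Lp.coeFn_smul c U.1
    have h1 := Lp.coeFn_smul c U.2.1
    have h2 := Lp.coeFn_smul c U.2.2
    refine ⟨fun i => ((hU.1 i).smul c).congr ?_ ?_,
      fun i j => ((hU.2 i j).smul c).congr ?_ ?_⟩
    · filter_upwards [h0] with x hx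
      exact hx.symm
    · filter_upwards [h1] with x hx
      exact (congrArg (fun v : Eucl d => v i) hx).symm
    · filter_upwards [h1] with x hx
      exact (congrArg (fun v : Eucl d => v j) hx).symm
    · filter_upwards [h2] with x hx
      exact (congrArg (fun v : EuclMat d => v (i, j)) hx).symm

/-- The weak gradient `Du ∈ L_p` of an element of `W²_p`. -/
def SobolevW2.grad {d : ℕ} {p : ENNReal} [Fact (1 ≤ p)] (U : SobolevW2 d p) :
    Lp (Eucl d) p (volume : Measure (Eucl d)) :=
  U.1.2.1

/-- The weak Hessian `D²u ∈ L_p` of an element of `W²_p`. -/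
def SobolevW2.hess {d : ℕ} {p : ENNReal} [Fact (1 ≤ p)] (U : SobolevW2 d p) :
    Lp (EuclMat d) p (volume : Measure (Eucl d)) :=
  U.1.2.2

end

/-! ### The Hardy–Littlewood maximal function and its small powers as weights. -/

section MaximalFunction

open Metric Set Filter Topology ENNReal

variable {d : ℕ}

/-! Everything reduces to the Fefferman–Phong type inequality ‖bu‖_p ≤ N K ‖Du‖_p for compactly
supported C¹ functions u, where K is the Morrey norm of b (`exists_eLpNorm_mul_le`).

The gap p < q leaves room to replace |b|^p by the weight w = M(|b|^q)^(p/q), with M the maximal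
operator. Lebesgue differentiation gives |b|^p ≤ w a.e. Since p/q < 1, Kolmogorov's inequality shows
that w keeps the Morrey decay, its average over B_t(y) being at most C K^p t^(-p), and that it gains
the A₁ property of Coifman and Rochberg, the same average being at most C w(y). Using A₁ at small
scales and the decay at large ones, the operator S, which integrates averages over B_t(y) in t from
0 to ∞, satisfies Sw ≤ C K w^(1-1/p) (`exists_weight`).

On the other side, |v| ≤ S|Dv| for compactly supported C¹ functions v
(`enorm_le_lintegral_setLAverage_fderiv`), and S is symmetric. Taking v = |u|^p and X = ∫|u|^p w,
Hölder's inequality gives X ≤ ∫|Dv| Sw ≤ C K p ‖Du‖_p X^(1-1/p). As X is finite, the power of X can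
be divided out.

The estimates for b Du apply this to the components D_j u. In the Sobolev case, mollification,
cutoffs and Fatou's lemma carry the inequality to weakly differentiable functions
(`eLpNorm_mul_le_of_hasWeakPartial`), so the operator is given on all of W²_p by its formula,
without extension by density. -/

/-- The uncentered Hardy–Littlewood maximal function over open balls. -/
noncomputable def maximalFun (g : Eucl d → ℝ≥0∞) (x : Eucl d) : ℝ≥0∞ :=
  ⨆ (c : Eucl d) (r : ℝ) (_ : x ∈ ball c r), ⨍⁻ y in ball c r, g y ∂volume

theorem setLAverage_le_maximalFun (g : Eucl d → ℝ≥0∞) {x c : Eucl d} {r : ℝ} (h : x ∈ ball c r) :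
    ⨍⁻ y in ball c r, g y ∂volume ≤ maximalFun g x :=
  le_iSup_of_le c <| le_iSup_of_le r <| le_iSup_of_le h le_rfl

theorem lt_maximalFun_iff {g : Eucl d → ℝ≥0∞} {x : Eucl d} {a : ℝ≥0∞} :
    a < maximalFun g x ↔ ∃ c r, x ∈ ball c r ∧ a < ⨍⁻ y in ball c r, g y ∂volume := by
  simp [maximalFun, lt_iSup_iff]

theorem isOpen_lt_maximalFun (g : Eucl d → ℝ≥0∞) (a : ℝ≥0∞) :
    IsOpen {x | a < maximalFun g x} := by
  have : {x | a < maximalFun g x}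
      = ⋃ (c : Eucl d) (r : ℝ) (_ : a < ⨍⁻ y in ball c r, g y ∂volume), ball c r := by
    ext x
    simp only [mem_ofPred_eq, lt_maximalFun_iff, mem_iUnion, exists_prop]
    exact exists_congr fun c => exists_congr fun r => and_comm
  rw [this]
  exact isOpen_iUnion fun c => isOpen_iUnion fun r => isOpen_iUnion fun _ => isOpen_ball

theorem measurable_maximalFun (g : Eucl d → ℝ≥0∞) : Measurable (maximalFun g) :=
  measurable_of_Ioi fun a => (isOpen_lt_maximalFun g a).measurableSet

theorem volume_ball_mul (c c' : Eucl d) {k : ℝ} (hk : 0 < k) (r : ℝ) :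
    volume (ball c (k * r)) = ENNReal.ofReal (k ^ d) * volume (ball c' r) := by
  rw [Measure.addHaar_ball_mul_of_pos _ _ hk, Measure.addHaar_ball_center volume c']
  simp

theorem volume_ball_ne_zero (c : Eucl d) {r : ℝ} (hr : 0 < r) : volume (ball c r) ≠ 0 :=
  (measure_ball_pos _ _ hr).ne'

theorem volume_ball_ne_top (c : Eucl d) (r : ℝ) : volume (ball c r) ≠ ⊤ :=
  measure_ball_lt_top.ne

theorem setLAverage_ball_le (g : Eucl d → ℝ≥0∞) {c c' : Eucl d} {k r : ℝ} (hk : 0 < k)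
    (h : ball c r ⊆ ball c' (k * r)) :
    ⨍⁻ y in ball c r, g y ∂volume ≤ ENNReal.ofReal (k ^ d) * ⨍⁻ y in ball c' (k * r), g y ∂volume := by
  have hk' : ENNReal.ofReal (k ^ d) ≠ 0 := by simpa using pow_pos hk d
  rw [setLAverage_eq, setLAverage_eq, volume_ball_mul c' c hk r, div_eq_mul_inv, div_eq_mul_inv,
    ENNReal.mul_inv (Or.inl hk') (Or.inl ofReal_ne_top), mul_left_comm, mul_comm (_)⁻¹ (_)⁻¹,
    mul_left_comm (ENNReal.ofReal _), ENNReal.mul_inv_cancel hk' ofReal_ne_top, mul_one]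
  gcongr

/-- The weak type `(1, 1)` bound. -/
theorem mul_volume_lt_maximalFun_le (hd : d ≠ 0) (g : Eucl d → ℝ≥0∞) (a : ℝ≥0∞) :
    a * volume {x | a < maximalFun g x} ≤ ENNReal.ofReal (4 ^ d) * ∫⁻ y, g y := by
  rcases eq_or_ne a 0 with rfl | ha
  · simp
  rcases eq_or_ne a ⊤ with rfl | ha'
  · simp
  rcases eq_or_ne (∫⁻ y, g y) ⊤ with hg | hg
  · rw [hg, ENNReal.mul_top (by simp)]
    exact le_top
  set t : Set (Eucl d × ℝ) := {b | 0 < b.2 ∧ a < ⨍⁻ y in ball b.1 b.2, g y ∂volume}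
  have key : ∀ b ∈ t, a * volume (ball b.1 b.2) ≤ ∫⁻ y in ball b.1 b.2, g y := by
    intro b hb
    have := hb.2.le
    rwa [setLAverage_eq, ENNReal.le_div_iff_mul_le (Or.inl (volume_ball_ne_zero _ hb.1))
      (Or.inl (volume_ball_ne_top _ _))] at this
  have hv0 : volume (ball (0 : Eucl d) 1) ≠ 0 := volume_ball_ne_zero _ one_pos
  -- Vitali's lemma needs bounded radii. They are bounded because a|B_r| ≤ ∫g < ∞ and |B_r| grows
  -- like r^d with d ≥ 1.
  obtain ⟨R, hR⟩ : ∃ R : ℝ, ∀ b ∈ t, b.2 ≤ R := by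
    set A : ℝ≥0∞ := (∫⁻ y, g y) / (a * volume (ball (0 : Eucl d) 1))
    have hA : A ≠ ⊤ := (ENNReal.div_lt_top hg (mul_ne_zero ha hv0)).ne
    refine ⟨max 1 A.toReal, fun b hb => ?_⟩
    rcases le_total b.2 1 with h1 | h1
    · exact le_max_of_le_left h1
    refine le_max_of_le_right ((le_self_pow₀ h1 hd).trans ?_)
    have h2 := (key b hb).trans (setLIntegral_le_lintegral _ _)
    have h3 := volume_ball_mul b.1 (0 : Eucl d) hb.1 1
    rw [mul_one] at h3
    rw [h3, mul_left_comm, ← ENNReal.le_div_iff_mul_le (Or.inl (mul_ne_zero ha hv0))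
      (Or.inl (ENNReal.mul_ne_top ha' (volume_ball_ne_top _ _)))] at h2
    exact (ENNReal.ofReal_le_iff_le_toReal hA).1 h2
  -- Any enlargement factor above 3 would do; 4 produces the constant 4^d.
  obtain ⟨u, hut, hdisj, hcov⟩ := Vitali.exists_disjoint_subfamily_covering_enlargement_ball t
    (fun b => b.1) (fun b => b.2) R hR 4 (by norm_num)
  have hucount : u.Countable := hdisj.countable_of_isOpen (fun _ _ => isOpen_ball)
    fun b hb => nonempty_ball.2 (hut hb).1
  have hsub : {x | a < maximalFun g x} ⊆ ⋃ b ∈ u, ball b.1 (4 * b.2) := by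
    intro x hx
    obtain ⟨c, r, hxr, har⟩ := lt_maximalFun_iff.1 hx
    obtain ⟨b, hb, hb'⟩ := hcov (c, r) ⟨pos_of_mem_ball hxr, har⟩
    exact mem_biUnion hb (hb' hxr)
  calc a * volume {x | a < maximalFun g x}
      ≤ a * ∑' b : u, volume (ball b.1.1 (4 * b.1.2)) := by
        gcongr
        exact (measure_mono hsub).trans (measure_biUnion_le _ hucount _)
    _ = ENNReal.ofReal (4 ^ d) * ∑' b : u, a * volume (ball b.1.1 b.1.2) := by
        rw [← ENNReal.tsum_mul_left, ← ENNReal.tsum_mul_left]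
        congr 1 with b
        rw [volume_ball_mul b.1.1 b.1.1 (by norm_num), mul_left_comm]
    _ ≤ ENNReal.ofReal (4 ^ d) * ∑' b : u, ∫⁻ y in ball b.1.1 b.1.2, g y := by
        gcongr with b
        exact key _ (hut b.2)
    _ ≤ ENNReal.ofReal (4 ^ d) * ∫⁻ y, g y := by
        gcongr
        rw [← lintegral_biUnion hucount (fun _ _ => measurableSet_ball) hdisj]
        exact setLIntegral_le_lintegral _ _

/-- If H < h < ∞, some k has 2^k H < h ≤ 2^(k+1) H, and that single term suffices. A discrete
substitute for the layer-cake formula. -/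
theorem rpow_le_dyadic_sum {s : ℝ} (hs : 0 < s) {H h : ℝ≥0∞} (hH : H ≠ 0) (hH' : H ≠ ⊤) :
    h ^ s ≤ H ^ s + ∑' k : ℕ, if 2 ^ k * H < h then (2 ^ (k + 1) * H) ^ s else 0 := by
  rcases eq_or_ne h ⊤ with rfl | hh
  · have : ∀ k : ℕ, (2 : ℝ≥0∞) ^ k * H < ⊤ := fun k =>
      ENNReal.mul_lt_top (ENNReal.pow_lt_top (by simp)) hH'.lt_top
    simp only [this, if_true]
    refine le_add_of_le_right ?_
    have hsum : ∑' _ : ℕ, H ^ s = ⊤ :=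
      ENNReal.tsum_const_eq_top_of_ne_zero (by simp [hH, hH'])
    rw [ENNReal.top_rpow_of_pos hs, ← hsum]
    gcongr with k
    exact le_mul_of_one_le_left' (one_le_pow₀ (by norm_num))
  have hex : ∃ n : ℕ, h ≤ 2 ^ n * H := by
    obtain ⟨n, hn⟩ := ENNReal.exists_nat_gt (ENNReal.div_lt_top hh hH).ne
    refine ⟨n, ?_⟩
    rw [← ENNReal.div_le_iff_le_mul (Or.inl hH) (Or.inl hH')]
    refine hn.le.trans ?_
    exact_mod_cast Nat.lt_two_pow_self.le
  classical
  rcases hn : Nat.find hex with _ | n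
  · refine le_add_of_le_left ?_
    have := Nat.find_spec hex
    rw [hn] at this
    gcongr
    simpa using this
  · refine le_add_of_le_right ((ENNReal.le_tsum n).trans' ?_)
    have h1 := Nat.find_spec hex
    rw [hn] at h1
    have h2 : 2 ^ n * H < h := not_le.1 (Nat.find_min hex (by omega))
    rw [if_pos h2]
    gcongr

/-- Kolmogorov's inequality: a weak type bound controls powers below one. -/
theorem exists_lintegral_rpow_le_of_weak {s : ℝ} (hs : 0 < s) (hs1 : s < 1) (C : ℝ≥0) :
    ∃ C' : ℝ≥0, ∀ {α : Type} [MeasurableSpace α] (μ : Measure α) (h : α → ℝ≥0∞) (H : ℝ≥0∞),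
      Measurable h → (∀ a, a * μ {x | a < h x} ≤ C * H * μ univ) →
      ∫⁻ x, h x ^ s ∂μ ≤ C' * H ^ s * μ univ := by
  -- The level 2^k H contributes 2^(s(k+1)) H^s times a measure of order 2^(-k), so θ is the ratio
  -- of a geometric series, convergent because s < 1.
  set θ : ℝ≥0∞ := 2 ^ (s - 1) with hθ
  have hθ1 : θ < 1 := ENNReal.rpow_lt_one_of_one_lt_of_neg (by norm_num) (by linarith)
  set T : ℝ≥0∞ := 1 + 2 ^ s * C * ∑' k : ℕ, θ ^ k with hT
  have hTtop : T ≠ ⊤ := by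
    rw [hT, ENNReal.tsum_geometric]
    refine ENNReal.add_ne_top.2 ⟨by simp, ENNReal.mul_ne_top (ENNReal.mul_ne_top ?_ (by simp)) ?_⟩
    · exact ENNReal.rpow_ne_top_of_nonneg hs.le (by simp)
    · exact ENNReal.inv_ne_top.2 (tsub_pos_of_lt hθ1).ne'
  refine ⟨T.toNNReal, fun {α} _ μ h H hm hw => ?_⟩
  rw [ENNReal.coe_toNNReal hTtop]
  rcases eq_or_ne (μ univ) 0 with hμ | hμ
  · simp [Measure.measure_univ_eq_zero.1 hμ]
  rcases eq_or_ne H ⊤ with rfl | hH'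
  · rw [ENNReal.top_rpow_of_pos hs, ENNReal.mul_top (by simp [hT]), ENNReal.top_mul hμ]
    exact le_top
  rcases eq_or_ne H 0 with rfl | hH
  · have h0 : h =ᵐ[μ] 0 := by
      have h1 : ∀ n : ℕ, ∀ᵐ x ∂μ, h x ≤ ((n : ℝ≥0∞) + 1)⁻¹ := by
        intro n
        have := hw ((n : ℝ≥0∞) + 1)⁻¹
        rw [mul_zero, zero_mul, nonpos_iff_eq_zero, mul_eq_zero] at this
        rw [ae_iff]
        simp only [not_le]
        exact this.resolve_left (by simp)
      filter_upwards [ae_all_iff.2 h1] with x hx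
      by_contra hne
      obtain ⟨n, hn⟩ := ENNReal.exists_inv_nat_lt hne
      refine absurd ((hx n).trans ?_) (not_le.2 hn)
      gcongr
      exact le_self_add
    rw [lintegral_congr_ae (g := fun _ => 0) (by filter_upwards [h0] with x hx; simp [hx, hs])]
    simp
  have hmeas : ∀ k : ℕ, Measurable fun x => if 2 ^ k * H < h x then (2 ^ (k + 1) * H) ^ s else 0 :=
    fun k => Measurable.ite (measurableSet_lt measurable_const hm) measurable_const measurable_const
  calc ∫⁻ x, h x ^ s ∂μ
      ≤ ∫⁻ x, H ^ s + ∑' k : ℕ, if 2 ^ k * H < h x then (2 ^ (k + 1) * H) ^ s else 0 ∂μ :=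
        lintegral_mono fun x => rpow_le_dyadic_sum hs hH hH'
    _ = H ^ s * μ univ + ∑' k : ℕ, (2 ^ (k + 1) * H) ^ s * μ {x | 2 ^ k * H < h x} := by
        rw [lintegral_add_left measurable_const, lintegral_const,
          lintegral_tsum fun k => (hmeas k).aemeasurable]
        congr 2 with k
        rw [← lintegral_indicator_const (measurableSet_lt measurable_const hm)]
        congr 1 with x
        simp [indicator_apply]
    _ ≤ H ^ s * μ univ + ∑' k : ℕ, 2 ^ s * C * H ^ s * μ univ * θ ^ k := by
        refine add_le_add le_rfl (ENNReal.tsum_le_tsum fun k => ?_)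
        have hz : (2 : ℝ≥0∞) ^ k * H ≠ 0 := by simp [hH]
        have hz' : (2 : ℝ≥0∞) ^ k * H ≠ ⊤ := ENNReal.mul_ne_top (by simp) hH'
        have hm' : μ {x | 2 ^ k * H < h x} ≤ C * H * μ univ / (2 ^ k * H) := by
          rw [ENNReal.le_div_iff_mul_le (Or.inl hz) (Or.inl hz'), mul_comm]
          exact hw _
        refine (mul_le_mul_right hm' _).trans (le_of_eq ?_)
        have e1 : (2 : ℝ≥0∞) ^ k * (θ ^ k) = (2 ^ s) ^ k := by
          rw [← mul_pow, hθ]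
          congr 1
          conv_lhs => rw [← ENNReal.rpow_one 2, ← ENNReal.rpow_mul,
            ← ENNReal.rpow_add _ _ (by norm_num) (by norm_num)]
          congr 1
          ring
        have e2 : ((2 : ℝ≥0∞) ^ (k + 1) * H) ^ s = 2 ^ s * (2 ^ k * θ ^ k) * H ^ s := by
          rw [ENNReal.mul_rpow_of_nonneg _ _ hs.le, e1, pow_succ,
            ENNReal.mul_rpow_of_nonneg _ _ hs.le, ← ENNReal.rpow_natCast, ← ENNReal.rpow_mul,
            mul_comm (k : ℝ), ENNReal.rpow_mul, ENNReal.rpow_natCast, mul_comm (2 ^ s)]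
        rw [e2, ENNReal.div_eq_inv_mul, ENNReal.mul_inv (Or.inl (by simp)) (Or.inl (by simp))]
        have c1 : (2 : ℝ≥0∞) ^ k * ((2 : ℝ≥0∞) ^ k)⁻¹ = 1 :=
          ENNReal.mul_inv_cancel (by simp) (by simp)
        have c2 : H * H⁻¹ = 1 := ENNReal.mul_inv_cancel hH hH'
        calc _ = 2 ^ s * C * H ^ s * μ univ * θ ^ k * (2 ^ k * (2 ^ k)⁻¹) * (H * H⁻¹) := by ring
          _ = _ := by rw [c1, c2, mul_one, mul_one]
    _ = T * H ^ s * μ univ := by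
        rw [ENNReal.tsum_mul_left, hT]
        ring

/-- A local bound for powers of the maximal function. -/
theorem exists_setLAverage_maximalFun_rpow_le (hd : d ≠ 0) {s : ℝ} (hs : 0 < s) (hs1 : s < 1) :
    ∃ C : ℝ≥0, ∀ (g : Eucl d → ℝ≥0∞) (y : Eucl d) (t : ℝ) (H : ℝ≥0∞), 0 < t →
      (⨍⁻ z in ball y (3 * t), g z ∂volume) ≤ H →
      (∀ c ρ, t ≤ ρ → (∃ x ∈ ball y t, x ∈ ball c ρ) → ⨍⁻ z in ball c ρ, g z ∂volume ≤ H) →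
      ⨍⁻ x in ball y t, maximalFun g x ^ s ∂volume ≤ C * H ^ s := by
  obtain ⟨C, hC⟩ := exists_lintegral_rpow_le_of_weak hs hs1 (Real.toNNReal (12 ^ d))
  refine ⟨C + 1, fun g y t H ht hnear hfar => ?_⟩
  -- Balls of radius at most t meeting B_t(y) lie in B_{3t}(y) and see only g₁, to which the weak
  -- type bound applies; larger balls have average at most H. Tripling the ball turns 4^d into 12^d.
  set g₁ := (ball y (3 * t)).indicator g
  have hpt : ∀ x ∈ ball y t, maximalFun g x ^ s ≤ maximalFun g₁ x ^ s + H ^ s := by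
    intro x hx
    have : maximalFun g x ≤ max (maximalFun g₁ x) H := by
      refine iSup_le fun c => iSup_le fun ρ => iSup_le fun hxc => ?_
      rcases le_total t ρ with h | h
      · exact le_max_of_le_right (hfar c ρ h ⟨x, hx, hxc⟩)
      · refine le_max_of_le_left (le_trans (le_of_eq ?_) (setLAverage_le_maximalFun g₁ hxc))
        refine setLAverage_congr_fun measurableSet_ball fun z hz => ?_
        refine (indicator_of_mem ?_ g).symm
        rw [mem_ball] at *
        have := dist_triangle4 z c x y
        rw [dist_comm c x] at this
        linarith
    rcases le_total (maximalFun g₁ x) H with h | h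
    · rw [max_eq_right h] at this
      exact le_add_of_le_right (by gcongr)
    · rw [max_eq_left h] at this
      exact le_add_of_le_left (by gcongr)
  have hw : ∀ a, a * (volume.restrict (ball y t)) {x | a < maximalFun g₁ x}
      ≤ (Real.toNNReal (12 ^ d) : ℝ≥0) * H * (volume.restrict (ball y t)) univ := by
    intro a
    calc a * (volume.restrict (ball y t)) {x | a < maximalFun g₁ x}
        ≤ a * volume {x | a < maximalFun g₁ x} := by
          gcongr
          exact Measure.restrict_le_self
      _ ≤ ENNReal.ofReal (4 ^ d) * ∫⁻ z, g₁ z := mul_volume_lt_maximalFun_le hd _ _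
      _ = ENNReal.ofReal (4 ^ d) * (volume (ball y (3 * t)) * ⨍⁻ z in ball y (3 * t), g z ∂volume) := by
          rw [measure_mul_setLAverage _ (volume_ball_ne_top _ _),
            lintegral_indicator measurableSet_ball]
      _ ≤ ENNReal.ofReal (4 ^ d) * (ENNReal.ofReal (3 ^ d) * volume (ball y t) * H) := by
          rw [volume_ball_mul y y (by norm_num)]
          gcongr
      _ = (Real.toNNReal (12 ^ d) : ℝ≥0) * H * (volume.restrict (ball y t)) univ := by
          rw [Measure.restrict_apply_univ, show (12 : ℝ) = 4 * 3 by norm_num, mul_pow,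
            show ((Real.toNNReal (4 ^ d * 3 ^ d) : ℝ≥0) : ℝ≥0∞)
              = ENNReal.ofReal (4 ^ d * 3 ^ d) from rfl, ENNReal.ofReal_mul (by positivity)]
          ring
  rw [setLAverage_eq]
  refine ENNReal.div_le_of_le_mul ?_
  calc ∫⁻ x in ball y t, maximalFun g x ^ s
      ≤ ∫⁻ x in ball y t, maximalFun g₁ x ^ s + H ^ s :=
        setLIntegral_mono' measurableSet_ball hpt
    _ = (∫⁻ x in ball y t, maximalFun g₁ x ^ s) + H ^ s * volume (ball y t) := by
        rw [lintegral_add_right _ measurable_const, lintegral_const, Measure.restrict_apply_univ]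
    _ ≤ C * H ^ s * volume (ball y t) + H ^ s * volume (ball y t) := by
        gcongr
        simpa using hC _ _ H (measurable_maximalFun g₁) hw
    _ = ((C + 1 : ℝ≥0) : ℝ≥0∞) * H ^ s * volume (ball y t) := by
        push_cast
        ring

/-- The Coifman–Rochberg A₁ property. A ball of radius ρ ≥ t meeting B_t(y) lies in B_{3ρ}(y), so
its average is at most 3^d times the maximal function at y. -/
theorem exists_setLAverage_maximalFun_rpow_le_self (hd : d ≠ 0) {s : ℝ} (hs : 0 < s)
    (hs1 : s < 1) :
    ∃ C : ℝ≥0, ∀ (g : Eucl d → ℝ≥0∞) (y : Eucl d) (t : ℝ), 0 < t →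
      ⨍⁻ x in ball y t, maximalFun g x ^ s ∂volume ≤ C * maximalFun g y ^ s := by
  obtain ⟨C, hC⟩ := exists_setLAverage_maximalFun_rpow_le hd hs hs1
  refine ⟨C * Real.toNNReal (3 ^ d) ^ s, fun g y t ht => ?_⟩
  have h3 : (1 : ℝ≥0∞) ≤ ENNReal.ofReal (3 ^ d) := by
    rw [ENNReal.one_le_ofReal]
    exact one_le_pow₀ (by norm_num)
  refine (hC g y t (ENNReal.ofReal (3 ^ d) * maximalFun g y) ht ?_ ?_).trans (le_of_eq ?_)
  · exact (setLAverage_le_maximalFun g (mem_ball_self (by positivity))).trans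
      (le_mul_of_one_le_left' h3)
  · rintro c ρ htρ ⟨x, hx, hxc⟩
    have hρ : 0 < ρ := ht.trans_le htρ
    refine (setLAverage_ball_le g (c' := y) (k := 3) (by norm_num) fun z hz => ?_).trans ?_
    · rw [mem_ball] at *
      have := dist_triangle4 z c x y
      rw [dist_comm c x] at this
      linarith
    · gcongr
      exact setLAverage_le_maximalFun g (mem_ball_self (by positivity))
  · rw [ENNReal.mul_rpow_of_nonneg _ _ hs.le, ENNReal.coe_mul,
      ENNReal.coe_rpow_of_nonneg _ hs.le, mul_assoc]
    rfl

/-- Morrey decay survives the maximal operator: the bound K t^(-q) decreases in t, so it serves for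
every radius at least t. -/
theorem exists_setLAverage_maximalFun_rpow_le_scale (hd : d ≠ 0) {s q : ℝ} (hs : 0 < s)
    (hs1 : s < 1) (hq : 0 < q) :
    ∃ C : ℝ≥0, ∀ (g : Eucl d → ℝ≥0∞) (K : ℝ≥0∞),
      (∀ y t, 0 < t → ⨍⁻ z in ball y t, g z ∂volume ≤ K * ENNReal.ofReal (t ^ (-q))) →
      ∀ (y : Eucl d) (t : ℝ), 0 < t →
      ⨍⁻ x in ball y t, maximalFun g x ^ s ∂volume ≤ C * (K ^ s * ENNReal.ofReal (t ^ (-(q * s)))) := by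
  obtain ⟨C, hC⟩ := exists_setLAverage_maximalFun_rpow_le hd hs hs1
  refine ⟨C, fun g K hg y t ht => ?_⟩
  refine (hC g y t (K * ENNReal.ofReal (t ^ (-q))) ht ?_ ?_).trans (le_of_eq ?_)
  · refine (hg y (3 * t) (by positivity)).trans ?_
    gcongr K * ENNReal.ofReal ?_
    exact Real.rpow_le_rpow_of_nonpos ht (by linarith) (by linarith)
  · rintro c ρ htρ -
    refine (hg c ρ (ht.trans_le htρ)).trans ?_
    gcongr K * ENNReal.ofReal ?_
    exact Real.rpow_le_rpow_of_nonpos ht htρ (by linarith)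
  · rw [ENNReal.mul_rpow_of_nonneg _ _ hs.le, ENNReal.ofReal_rpow_of_nonneg (by positivity) hs.le,
      ← Real.rpow_mul ht.le]
    simp

/-- Lebesgue differentiation: a function is dominated by its maximal function. -/
theorem ae_enorm_le_maximalFun (hd : d ≠ 0) {f : Eucl d → ℝ} (hf : LocallyIntegrable f) :
    ∀ᵐ x, ‖f x‖ₑ ≤ maximalFun (fun y => ‖f y‖ₑ) x := by
  have : Nonempty (Fin d) := ⟨⟨0, Nat.pos_of_ne_zero hd⟩⟩
  filter_upwards [IsUnifLocDoublingMeasure.ae_tendsto_average volume hf 1] with x hx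
  have h1 := hx (l := 𝓝[>] (0 : ℝ)) (fun _ => x) id tendsto_id (by
    filter_upwards [self_mem_nhdsWithin] with r hr
    exact mem_closedBall_self (by simpa using le_of_lt hr))
  have h2 := (continuous_enorm.tendsto _).comp h1
  refine le_of_tendsto h2 ?_
  filter_upwards [self_mem_nhdsWithin] with r hr
  refine le_trans ?_ (setLAverage_le_maximalFun _ (mem_ball_self hr))
  -- The differentiation theorem uses closed balls, the maximal function open ones; spheres are
  -- null.
  have hae : (closedBall x r : Set (Eucl d)) =ᵐ[volume] ball x r :=
    (ae_eq_of_subset_of_measure_ge ball_subset_closedBall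
      (Measure.addHaar_closedBall_eq_addHaar_ball volume x r).le
      measurableSet_ball.nullMeasurableSet measure_closedBall_lt_top.ne).symm
  simp only [Function.comp, id]
  rw [← setLAverage_congr hae]
  exact enorm_integral_le_lintegral_enorm _

/-- Integrating the averages of a weight over all scales. -/
theorem exists_lintegral_scales_le {p : ℝ} (hp : 1 < p) (A : ℝ≥0) :
    ∃ C : ℝ≥0, ∀ (m : ℝ → ℝ≥0∞) (W K : ℝ≥0∞), K ≠ ⊤ → (∀ t, 0 < t → m t ≤ A * W) →
      (∀ t, 0 < t → m t ≤ A * (K ^ p * ENNReal.ofReal (t ^ (-p)))) →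
      ∫⁻ t in Ioi 0, m t ≤ C * K * W ^ (1 - 1 / p) := by
  have hp0 : 0 < p := by linarith
  have he : 0 < 1 - 1 / p := by
    rw [sub_pos, div_lt_one hp0]; exact hp
  -- Short scales contribute A and the tail A/(p-1). The last summand only keeps the constant
  -- nonzero, which makes the right side infinite when `W = ⊤`.
  refine ⟨A * (1 + Real.toNNReal (1 / (p - 1))) + 1, fun m W K hK h1 h2 => ?_⟩
  have hzero : (∀ t, 0 < t → m t = 0) → ∫⁻ t in Ioi 0, m t = 0 := fun h => by
    rw [setLIntegral_congr_fun measurableSet_Ioi (g := fun _ => 0) fun t ht => h t ht]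
    simp
  rcases eq_or_ne W 0 with rfl | hW
  · rw [hzero fun t ht => by simpa using h1 t ht]
    exact zero_le
  rcases eq_or_ne K 0 with rfl | hK0
  · rw [hzero fun t ht => by simpa [hp0] using h2 t ht]
    exact zero_le
  rcases eq_or_ne W ⊤ with rfl | hW'
  · rw [ENNReal.top_rpow_of_pos he, ENNReal.mul_top (mul_ne_zero (by simp) hK0)]
    exact le_top
  lift K to ℝ≥0 using hK
  lift W to ℝ≥0 using hW'
  have hK1 : 0 < (K : ℝ) := by simpa [pos_iff_ne_zero] using hK0
  have hW1 : 0 < (W : ℝ) := by simpa [pos_iff_ne_zero] using hW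
  -- The scale at which the two bounds agree: W = K^p δ^(-p).
  set δ : ℝ := K * (W : ℝ) ^ (-(1 / p)) with hδ
  have hδ0 : 0 < δ := by positivity
  have i1 : ∫⁻ t in Ioc 0 δ, m t ≤ A * W * ENNReal.ofReal δ := by
    calc ∫⁻ t in Ioc 0 δ, m t ≤ ∫⁻ _ in Ioc 0 δ, (A : ℝ≥0∞) * W :=
          setLIntegral_mono' measurableSet_Ioc fun t ht => h1 t ht.1
      _ = _ := by simp
  have i2 : ∫⁻ t in Ioi δ, m t
      ≤ A * ((K : ℝ≥0∞) ^ p * ENNReal.ofReal (δ ^ (1 - p) * (1 / (p - 1)))) := by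
    calc ∫⁻ t in Ioi δ, m t
        ≤ ∫⁻ t in Ioi δ, A * ((K : ℝ≥0∞) ^ p * ENNReal.ofReal (t ^ (-p))) :=
          setLIntegral_mono' measurableSet_Ioi fun t ht => h2 t (hδ0.trans ht)
      _ = A * ((K : ℝ≥0∞) ^ p * ∫⁻ t in Ioi δ, ENNReal.ofReal (t ^ (-p))) := by
          rw [lintegral_const_mul _ (by fun_prop), lintegral_const_mul _ (by fun_prop)]
      _ = _ := by
          rw [← ofReal_integral_eq_lintegral_ofReal
            (integrableOn_Ioi_rpow_of_lt (by linarith) hδ0)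
            (by filter_upwards [ae_restrict_mem measurableSet_Ioi] with t ht
                exact Real.rpow_nonneg (hδ0.trans ht).le _),
            integral_Ioi_rpow_of_lt (by linarith) hδ0]
          congr 3
          rw [show -p + 1 = -(p - 1) by ring, div_neg, neg_div, neg_neg, show -(p-1) = 1 - p by ring]
          ring
  have e1 : (W : ℝ) * δ = K * (W : ℝ) ^ (1 - 1 / p) := by
    rw [hδ, sub_eq_add_neg, Real.rpow_add hW1, Real.rpow_one]
    ring
  have e2 : (K : ℝ) ^ p * δ ^ (1 - p) = K * (W : ℝ) ^ (1 - 1 / p) := by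
    rw [hδ, Real.mul_rpow hK1.le (by positivity), ← Real.rpow_mul hW1.le, ← mul_assoc,
      ← Real.rpow_add hK1]
    congr 2
    · simp
    · field_simp
      ring
  have cW : (W : ℝ≥0∞) = ENNReal.ofReal W := (ENNReal.ofReal_coe_nnreal).symm
  have cK : (K : ℝ≥0∞) = ENNReal.ofReal K := (ENNReal.ofReal_coe_nnreal).symm
  have hz : (K : ℝ≥0∞) * (W : ℝ≥0∞) ^ (1 - 1 / p) = ENNReal.ofReal (K * (W : ℝ) ^ (1 - 1 / p)) := by
    rw [ENNReal.ofReal_mul hK1.le, ← ENNReal.ofReal_rpow_of_pos hW1, ← cW, ← cK]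
  have f1 : (W : ℝ≥0∞) * ENNReal.ofReal δ = K * (W : ℝ≥0∞) ^ (1 - 1 / p) := by
    rw [hz, ← e1, ENNReal.ofReal_mul hW1.le, cW]
  have f2 : (K : ℝ≥0∞) ^ p * ENNReal.ofReal (δ ^ (1 - p) * (1 / (p - 1)))
      = K * (W : ℝ≥0∞) ^ (1 - 1 / p) * ENNReal.ofReal (1 / (p - 1)) := by
    rw [hz, ← e2, ENNReal.ofReal_mul (by positivity), ENNReal.ofReal_mul (by positivity),
      ← ENNReal.ofReal_rpow_of_pos hK1, ← cK, mul_assoc]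
  rw [← Ioc_union_Ioi_eq_Ioi hδ0.le, lintegral_union measurableSet_Ioi
    (Set.disjoint_left.2 fun t h h' => not_lt.2 h.2 h')]
  refine (add_le_add i1 i2).trans ?_
  rw [mul_assoc, f1, f2]
  push_cast
  calc _ = (A : ℝ≥0∞) * (1 + (Real.toNNReal (1 / (p - 1)) : ℝ≥0∞)) * K * (W : ℝ≥0∞) ^ (1 - 1 / p) := by
        rw [ENNReal.ofReal]; ring
    _ ≤ _ := by
        gcongr
        exact le_self_add

end MaximalFunction

/-! ### Pointwise control of a function by averages of its gradient, and duality. -/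

section Representation

open Metric Set Filter Topology ENNReal

variable {d : ℕ}

theorem setLIntegral_ball_comp_add_smul {F : Eucl d → ℝ≥0∞} (hF : Measurable F) (x : Eucl d)
    {t : ℝ} (ht : 0 < t) :
    ∫⁻ z in ball 0 1, F (x + t • z)
      = volume (ball (0 : Eucl d) 1) * ⨍⁻ y in ball x t, F y ∂volume := by
  have hpos : ENNReal.ofReal (t ^ d) ≠ 0 := by simpa using pow_pos ht d
  have hv0 : volume (ball (0 : Eucl d) 1) ≠ 0 := volume_ball_ne_zero _ one_pos
  have hvt : volume (ball (0 : Eucl d) 1) ≠ ⊤ := volume_ball_ne_top _ _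
  have h1 : ∫⁻ z in ball 0 1, F (x + t • z)
      = ∫⁻ z, (ball x t).indicator F (x + t • z) := by
    rw [← lintegral_indicator measurableSet_ball]
    congr 1 with z
    have : z ∈ ball (0 : Eucl d) 1 ↔ x + t • z ∈ ball x t := by
      simp [dist_eq_norm, norm_smul, abs_of_pos ht, ht]
    by_cases hz : z ∈ ball (0 : Eucl d) 1
    · rw [indicator_of_mem hz, indicator_of_mem (this.1 hz)]
    · rw [indicator_of_notMem hz, indicator_of_notMem fun h => hz (this.2 h)]
  have hG : Measurable fun y => (ball x t).indicator F (x + y) :=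
    (hF.indicator measurableSet_ball).comp (measurable_const_add x)
  have h2 := lintegral_map (μ := volume) hG (measurable_const_smul t)
  have h3 : volume (ball x t) = ENNReal.ofReal (t ^ d) * volume (ball (0 : Eucl d) 1) := by
    simpa using volume_ball_mul x 0 ht 1
  rw [h1, ← h2, Measure.map_addHaar_smul volume ht.ne', lintegral_smul_measure,
    lintegral_add_left_eq_self, lintegral_indicator measurableSet_ball, setLAverage_eq, h3,
    finrank_euclideanSpace_fin, abs_of_pos (by positivity), ENNReal.ofReal_inv_of_pos (by positivity),
    div_eq_mul_inv, ENNReal.mul_inv (Or.inl hpos) (Or.inl ofReal_ne_top), smul_eq_mul]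
  calc _ = (ENNReal.ofReal (t ^ d))⁻¹ * (∫⁻ y in ball x t, F y) * 1 := by rw [mul_one]
    _ = _ := by
      rw [← ENNReal.mul_inv_cancel hv0 hvt]
      ring

theorem enorm_le_lintegral_ray {v : Eucl d → ℝ} (hv : ContDiff ℝ 1 v) (hc : HasCompactSupport v)
    (x : Eucl d) {z : Eucl d} (hz : z ≠ 0) :
    ‖v x‖ₑ ≤ ∫⁻ t in Ioi (0 : ℝ), ‖fderiv ℝ v (x + t • z)‖ₑ * ‖z‖ₑ := by
  -- The direction is reversed because the one-dimensional bound integrates over `Iic 0`; reflecting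
  -- t restores the ray x + tz.
  set f : ℝ → ℝ := fun t => v (x - t • z)
  have hf : ContDiff ℝ 1 f := hv.comp (contDiff_const.sub (contDiff_id.smul contDiff_const))
  have hemb : IsClosedEmbedding fun t : ℝ => x - t • z :=
    (Homeomorph.subLeft x).isClosedEmbedding.comp (isClosedEmbedding_smul_left hz)
  have hfc : HasCompactSupport f := hc.comp_isClosedEmbedding hemb
  have h1 := hfc.enorm_le_lintegral_Ici_deriv hf 0
  have h2 : f 0 = v x := by simp [f]
  rw [h2] at h1
  refine h1.trans ?_
  have h3 : ∀ t, ‖deriv f t‖ₑ ≤ ‖fderiv ℝ v (x - t • z)‖ₑ * ‖z‖ₑ := by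
    intro t
    have hg : HasDerivAt (fun t : ℝ => x - t • z) (-z) t := by
      simpa using ((hasDerivAt_id t).smul_const z).const_sub x
    have : HasDerivAt f (fderiv ℝ v (x - t • z) (-z)) t :=
      ((hv.differentiable one_ne_zero _).hasFDerivAt.comp_hasDerivAt t hg)
    rw [this.deriv]
    refine (ContinuousLinearMap.le_opENorm _ _).trans (by rw [enorm_neg])
  calc ∫⁻ t in Iic (0 : ℝ), ‖deriv f t‖ₑ
      ≤ ∫⁻ t in Iic (0 : ℝ), ‖fderiv ℝ v (x - t • z)‖ₑ * ‖z‖ₑ := lintegral_mono fun t => h3 t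
    _ = ∫⁻ t in Ici (0 : ℝ), ‖fderiv ℝ v (x + t • z)‖ₑ * ‖z‖ₑ := by
      rw [← lintegral_indicator measurableSet_Iic, ← lintegral_indicator measurableSet_Ici,
        ← lintegral_neg_eq_self]
      congr 1 with t
      by_cases ht : 0 ≤ t
      · rw [indicator_of_mem (by simpa using ht), indicator_of_mem (by simpa using ht)]
        simp [sub_eq_add_neg]
      · rw [indicator_of_notMem (by simpa using ht), indicator_of_notMem (by simpa using ht)]
    _ = _ := setLIntegral_congr Ioi_ae_eq_Ici.symm

/-- A compactly supported function is dominated by the averages of its gradient over all scales. -/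
theorem enorm_le_lintegral_setLAverage_fderiv (hd : d ≠ 0) {v : Eucl d → ℝ} (hv : ContDiff ℝ 1 v)
    (hc : HasCompactSupport v) (x : Eucl d) :
    ‖v x‖ₑ ≤ ∫⁻ t in Ioi (0 : ℝ), ⨍⁻ y in ball x t, ‖fderiv ℝ v y‖ₑ ∂volume := by
  have hne : Nonempty (Fin d) := ⟨⟨0, Nat.pos_of_ne_zero hd⟩⟩
  have hv0 : volume (ball (0 : Eucl d) 1) ≠ 0 := volume_ball_ne_zero _ one_pos
  have hvt : volume (ball (0 : Eucl d) 1) ≠ ⊤ := volume_ball_ne_top _ _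
  have hcont : Continuous (fderiv ℝ v) := hv.continuous_fderiv one_ne_zero
  -- The ray bound is averaged over all z in the unit ball, where |z| ≤ 1. This yields ball averages
  -- directly, without polar coordinates.
  rw [← ENNReal.mul_le_mul_iff_right hv0 hvt]
  calc volume (ball (0 : Eucl d) 1) * ‖v x‖ₑ
      = ∫⁻ _ in ball (0 : Eucl d) 1, ‖v x‖ₑ := by simp [mul_comm]
    _ ≤ ∫⁻ z in ball (0 : Eucl d) 1, ∫⁻ t in Ioi (0 : ℝ), ‖fderiv ℝ v (x + t • z)‖ₑ := by
      refine lintegral_mono_ae ?_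
      have hz : ∀ᵐ z : Eucl d, z ≠ 0 := by
        rw [ae_iff]; simp
      filter_upwards [ae_restrict_mem measurableSet_ball, ae_restrict_of_ae hz] with z hz1 hz0
      refine (enorm_le_lintegral_ray hv hc x hz0).trans (lintegral_mono fun t => ?_)
      refine mul_le_of_le_one_right' ?_
      have : ‖z‖ ≤ 1 := by simpa using (mem_ball.1 hz1).le
      rw [← ofReal_norm]
      exact ENNReal.ofReal_le_one.2 this
    _ = ∫⁻ t in Ioi (0 : ℝ), ∫⁻ z in ball (0 : Eucl d) 1, ‖fderiv ℝ v (x + t • z)‖ₑ := by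
      refine lintegral_lintegral_swap (Measurable.aemeasurable ?_)
      exact (hcont.comp (continuous_const.add
        (continuous_snd.smul continuous_fst))).enorm.measurable
    _ = ∫⁻ t in Ioi (0 : ℝ), volume (ball (0 : Eucl d) 1)
          * ⨍⁻ y in ball x t, ‖fderiv ℝ v y‖ₑ ∂volume :=
      setLIntegral_congr_fun measurableSet_Ioi fun t ht =>
        setLIntegral_ball_comp_add_smul hcont.enorm.measurable x ht
    _ = _ := lintegral_const_mul' _ _ hvt

/-- The averages over balls are given by a symmetric measurable kernel. -/
theorem exists_setLAverage_kernel (d : ℕ) : ∃ k : ℝ → Eucl d → Eucl d → ℝ≥0∞,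
    (Measurable fun a : ℝ × Eucl d × Eucl d => k a.1 a.2.1 a.2.2) ∧
    (∀ t x y, k t x y = k t y x) ∧
    ∀ (g : Eucl d → ℝ≥0∞), Measurable g → ∀ x, ∀ t ∈ Ioi (0 : ℝ),
      ⨍⁻ y in ball x t, g y ∂volume = ∫⁻ y, k t x y * g y := by
  set V := volume (ball (0 : Eucl d) 1)
  -- Balls of equal radius have equal volume, so the normalized indicator of |x - y| < t is
  -- symmetric in x and y.
  set k : ℝ → Eucl d → Eucl d → ℝ≥0∞ := fun t x y =>
    {a : ℝ × Eucl d × Eucl d | dist a.2.1 a.2.2 < a.1}.indicator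
      (fun a => (ENNReal.ofReal (a.1 ^ d) * V)⁻¹) (t, x, y)
  refine ⟨k, ?_, ?_, ?_⟩
  · exact Measurable.indicator (by fun_prop) (measurableSet_lt (by fun_prop) (by fun_prop))
  · intro t x y
    simp [k, indicator_apply, dist_comm]
  · intro g hg x t ht
    have h3 : volume (ball x t) = ENNReal.ofReal (t ^ d) * V := by
      simpa using volume_ball_mul x 0 (mem_Ioi.1 ht) 1
    rw [setLAverage_eq, h3, div_eq_mul_inv, mul_comm, ← lintegral_indicator measurableSet_ball,
      ← lintegral_const_mul _ (hg.indicator measurableSet_ball)]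
    congr 1 with y
    by_cases h : dist x y < t
    · simp [k, indicator_apply, h, dist_comm y x]
    · simp [k, indicator_apply, h, dist_comm y x]

/-- Symmetry of the averaging operators, integrated over all scales. -/
theorem lintegral_mul_lintegral_setLAverage_comm {f w : Eucl d → ℝ≥0∞} (hf : Measurable f)
    (hw : Measurable w) :
    ∫⁻ x, w x * ∫⁻ t in Ioi (0 : ℝ), ⨍⁻ y in ball x t, f y ∂volume
      = ∫⁻ y, f y * ∫⁻ t in Ioi (0 : ℝ), ⨍⁻ x in ball y t, w x ∂volume := by
  obtain ⟨k, hk, hsymm, havg⟩ := exists_setLAverage_kernel d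
  set ν := (volume.restrict (Ioi (0 : ℝ)))
  have hG : Measurable fun a : (Eucl d) × (ℝ × Eucl d) => w a.1 * (k a.2.1 a.1 a.2.2 * f a.2.2) := by
    refine (hw.comp measurable_fst).mul (Measurable.mul ?_ (by fun_prop))
    exact hk.comp (f := fun a : (Eucl d) × (ℝ × Eucl d) => (a.2.1, a.1, a.2.2)) (by fun_prop)
  calc ∫⁻ x, w x * ∫⁻ t in Ioi (0 : ℝ), ⨍⁻ y in ball x t, f y ∂volume
      = ∫⁻ x, ∫⁻ a, w x * (k a.1 x a.2 * f a.2) ∂(ν.prod volume) := by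
        congr 1 with x
        have hm : Measurable fun a : ℝ × Eucl d => k a.1 x a.2 * f a.2 :=
          (hk.comp (f := fun a : ℝ × Eucl d => (a.1, x, a.2)) (by fun_prop)).mul (by fun_prop)
        rw [lintegral_const_mul _ hm, lintegral_prod _ hm.aemeasurable]
        congr 1
        exact setLIntegral_congr_fun measurableSet_Ioi fun t ht => havg f hf x t ht
    _ = ∫⁻ a, (∫⁻ x, w x * (k a.1 x a.2 * f a.2)) ∂(ν.prod volume) :=
        lintegral_lintegral_swap hG.aemeasurable
    _ = ∫⁻ y, ∫⁻ t, (∫⁻ x, w x * (k t x y * f y)) ∂ν :=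
        lintegral_prod_symm' _ (Measurable.lintegral_prod_left' hG)
    _ = ∫⁻ y, f y * ∫⁻ t in Ioi (0 : ℝ), ⨍⁻ x in ball y t, w x ∂volume := by
        congr 1 with y
        have hm : Measurable fun a : ℝ × Eucl d => k a.1 y a.2 * w a.2 :=
          (hk.comp (f := fun a : ℝ × Eucl d => (a.1, y, a.2)) (by fun_prop)).mul (by fun_prop)
        have e : ∀ t, ∫⁻ x, w x * (k t x y * f y) = f y * ∫⁻ x, k t y x * w x := by
          intro t
          have hmt : Measurable fun x => k t y x * w x :=
            hm.comp (measurable_prodMk_left (x := t))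
          rw [← lintegral_const_mul _ hmt]
          congr 1 with x
          rw [hsymm t x y]
          ring
        simp_rw [e]
        rw [lintegral_const_mul _ hm.lintegral_prod_right']
        congr 1
        exact (setLIntegral_congr_fun measurableSet_Ioi fun t ht => havg w hw y t ht).symm

/-- By symmetry the averaging passes from the gradient to the weight, where the A₁ and Morrey bounds
are available. -/
theorem lintegral_enorm_mul_le (hd : d ≠ 0) {v : Eucl d → ℝ} (hv : ContDiff ℝ 1 v)
    (hc : HasCompactSupport v) {w : Eucl d → ℝ≥0∞} (hw : Measurable w) :
    ∫⁻ x, ‖v x‖ₑ * w x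
      ≤ ∫⁻ y, ‖fderiv ℝ v y‖ₑ * ∫⁻ t in Ioi (0 : ℝ), ⨍⁻ x in ball y t, w x ∂volume := by
  rw [← lintegral_mul_lintegral_setLAverage_comm
    (hv.continuous_fderiv one_ne_zero).enorm.measurable hw]
  refine lintegral_mono fun x => ?_
  rw [mul_comm]
  gcongr
  exact enorm_le_lintegral_setLAverage_fderiv hd hv hc x

end Representation

/-! ### The weighted inequality for compactly supported C¹ functions. -/

section FeffermanPhong

open Metric Set Filter Topology ENNReal

variable {d : ℕ}

theorem setLAverage_rpow_le_morreyNorm {q : ENNReal} (hq0 : q ≠ 0) (hq : q ≠ ⊤) (b : Eucl d → ℝ)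
    (y : Eucl d) {t : ℝ} (ht : 0 < t) :
    ⨍⁻ z in ball y t, ‖b z‖ₑ ^ q.toReal ∂volume
      ≤ morreyNorm q 1 b ^ q.toReal * ENNReal.ofReal (t ^ (-q.toReal)) := by
  have hQ : 0 < q.toReal := ENNReal.toReal_pos hq0 hq
  have h1 : ENNReal.ofReal t * avgNorm q b y t ≤ morreyNorm q 1 b := by
    refine le_iSup_of_le t (le_iSup_of_le ht ?_)
    rw [Real.rpow_one]
    gcongr
    exact le_iSup (fun x => avgNorm q b x t) y
  have h2 : ⨍⁻ z in ball y t, ‖b z‖ₑ ^ q.toReal ∂volume = avgNorm q b y t ^ q.toReal := by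
    rw [avgNorm, eLpNorm_eq_lintegral_rpow_enorm_toReal hq0 hq, ← ENNReal.rpow_mul,
      one_div_mul_cancel hQ.ne', ENNReal.rpow_one, setLAverage_eq']
  have ht' : ENNReal.ofReal t ≠ 0 := by simpa using ht
  have h3 : avgNorm q b y t ≤ morreyNorm q 1 b * ENNReal.ofReal t⁻¹ := by
    rw [ENNReal.ofReal_inv_of_pos ht, ← div_eq_mul_inv,
      ENNReal.le_div_iff_mul_le (Or.inl ht') (Or.inl ofReal_ne_top), mul_comm]
    exact h1
  rw [h2, Real.rpow_neg ht.le, ← Real.inv_rpow ht.le,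
    ← ENNReal.ofReal_rpow_of_nonneg (by positivity) hQ.le,
    ← ENNReal.mul_rpow_of_nonneg _ _ hQ.le]
  gcongr

/-- A Morrey function is dominated by a weight which satisfies the `A₁` condition in integrated
form. -/
theorem exists_weight (hd : d ≠ 0) {p q : ENNReal} (hp : 1 < p) (hpq : p < q) (hq : q < ⊤) :
    ∃ C : ℝ≥0, ∀ b : Eucl d → ℝ, MemMorrey q 1 b → ∃ w : Eucl d → ℝ≥0∞, Measurable w ∧
      (∀ᵐ x, ‖b x‖ₑ ^ p.toReal ≤ w x) ∧ (∀ y r, 0 < r → ∫⁻ x in ball y r, w x ≠ ⊤) ∧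
      ∀ y, ∫⁻ t in Ioi (0 : ℝ), ⨍⁻ x in ball y t, w x ∂volume
        ≤ C * morreyNorm q 1 b * w y ^ (1 - 1 / p.toReal) := by
  have hp' : p ≠ ⊤ := (hpq.trans hq).ne
  have hq0 : q ≠ 0 := (hpq.trans_le' zero_le).ne'
  have hP : 1 < p.toReal := by
    simpa using (ENNReal.toReal_lt_toReal (by simp) hp').2 hp
  have hPQ : p.toReal < q.toReal := (ENNReal.toReal_lt_toReal hp' hq.ne).2 hpq
  set P := p.toReal
  set Q := q.toReal
  have hQ : 0 < Q := by linarith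
  have hs : 0 < P / Q := by positivity
  have hs1 : P / Q < 1 := (div_lt_one hQ).2 hPQ
  obtain ⟨C₁, hC₁⟩ := exists_setLAverage_maximalFun_rpow_le_self hd hs hs1
  obtain ⟨C₂, hC₂⟩ := exists_setLAverage_maximalFun_rpow_le_scale hd hs hs1 hQ
  obtain ⟨C, hC⟩ := exists_lintegral_scales_le hP (max C₁ C₂)
  refine ⟨C, fun b hb => ?_⟩
  have hK : morreyNorm q 1 b ≠ ⊤ := hb.2.ne
  set g : Eucl d → ℝ≥0∞ := fun x => ‖b x‖ₑ ^ Q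
  have hg : ∀ y t, 0 < t → ⨍⁻ z in ball y t, g z ∂volume
      ≤ ((morreyNorm q 1 b ^ Q).toNNReal : ℝ≥0) * ENNReal.ofReal (t ^ (-Q)) := by
    intro y t ht
    rw [ENNReal.coe_toNNReal (ENNReal.rpow_ne_top_of_nonneg hQ.le hK)]
    exact setLAverage_rpow_le_morreyNorm hq0 hq.ne b y ht
  have hscale : ∀ (y : Eucl d) (t : ℝ), 0 < t →
      ⨍⁻ x in ball y t, maximalFun g x ^ (P / Q) ∂volume
        ≤ C₂ * (morreyNorm q 1 b ^ P * ENNReal.ofReal (t ^ (-P))) := by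
    intro y t ht
    have := hC₂ g _ hg y t ht
    rwa [ENNReal.coe_toNNReal (ENNReal.rpow_ne_top_of_nonneg hQ.le hK), ← ENNReal.rpow_mul,
      mul_div_cancel₀ _ hQ.ne'] at this
  have hfin : ∀ {f : Eucl d → ℝ≥0∞} {y : Eucl d} {t : ℝ}, 0 < t →
      ⨍⁻ x in ball y t, f x ∂volume ≠ ⊤ → ∫⁻ x in ball y t, f x ≠ ⊤ := by
    intro f y t ht h
    rw [← measure_mul_setLAverage _ (volume_ball_ne_top y t)]
    exact ENNReal.mul_ne_top (volume_ball_ne_top y t) h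
  refine ⟨fun x => maximalFun g x ^ (P / Q), (measurable_maximalFun g).pow_const _, ?_, ?_, ?_⟩
  -- Finiteness of the Morrey norm supplies the local integrability required by Lebesgue
  -- differentiation.
  · have hloc : LocallyIntegrable fun x => ‖b x‖ ^ Q := by
      intro x
      refine ⟨ball x 1, ball_mem_nhds x one_pos, ?_, ?_⟩
      · exact (hb.1.norm.aemeasurable.pow_const Q).aestronglyMeasurable.restrict
      · rw [hasFiniteIntegral_iff_enorm]
        simp_rw [Real.enorm_rpow_of_nonneg (norm_nonneg _) hQ.le, enorm_norm]
        exact (hfin one_pos (ne_top_of_le_ne_top (ENNReal.mul_ne_top (by simp) ofReal_ne_top)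
          (hg x 1 one_pos))).lt_top
    filter_upwards [ae_enorm_le_maximalFun hd hloc] with x hx
    simp_rw [Real.enorm_rpow_of_nonneg (norm_nonneg _) hQ.le, enorm_norm] at hx
    calc ‖b x‖ₑ ^ P = (‖b x‖ₑ ^ Q) ^ (P / Q) := by
          rw [← ENNReal.rpow_mul, mul_div_cancel₀ _ hQ.ne']
      _ ≤ maximalFun g x ^ (P / Q) := by gcongr
  · intro y r hr
    refine hfin hr (ne_top_of_le_ne_top ?_ (hscale y r hr))
    exact ENNReal.mul_ne_top (by simp) (ENNReal.mul_ne_top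
      (ENNReal.rpow_ne_top_of_nonneg (by linarith) hK) ofReal_ne_top)
  · intro y
    refine hC _ _ _ hK (fun t ht => (hC₁ g y t ht).trans ?_) fun t ht => (hscale y t ht).trans ?_
    · gcongr
      exact le_max_left _ _
    · gcongr
      exact le_max_right _ _

theorem exists_eLpNorm_mul_le (hd : d ≠ 0) {p q : ENNReal} (hp : 1 < p) (hpq : p < q)
    (hq : q < ⊤) :
    ∃ N : ℝ≥0, ∀ b : Eucl d → ℝ, MemMorrey q 1 b → ∀ u : Eucl d → ℝ, ContDiff ℝ 1 u →
      HasCompactSupport u →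
      eLpNorm (fun x => b x * u x) p volume ≤ N * morreyNorm q 1 b * eLpNorm (fderiv ℝ u) p volume := by
  obtain ⟨C, hC⟩ := exists_weight hd hp hpq hq
  have hp0 : p ≠ 0 := (zero_lt_one.trans hp).ne'
  have hp' : p ≠ ⊤ := (hpq.trans hq).ne
  have hP : 1 < p.toReal := by
    simpa using (ENNReal.toReal_lt_toReal (by simp) hp').2 hp
  -- The factor p comes from |D|u|^p| ≤ p|u|^(p-1)|Du|.
  refine ⟨p.toNNReal * C, fun b hb u hu hc => ?_⟩
  obtain ⟨w, hwm, hbw, hwfin, hS⟩ := hC b hb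
  set K := morreyNorm q 1 b
  rw [eLpNorm_eq_lintegral_rpow_enorm_toReal hp0 hp', eLpNorm_eq_lintegral_rpow_enorm_toReal hp0 hp']
  have hPnn : (p.toNNReal : ℝ) = p.toReal := rfl
  set P := p.toReal
  have hP0 : 0 < P := by linarith
  have hP1 : 0 < P - 1 := by linarith
  have he : 0 < 1 - 1 / P := by
    rw [sub_pos, div_lt_one hP0]; exact hP
  have hconj : P.HolderConjugate (P / (P - 1)) := Real.HolderConjugate.conjExponent hP
  set D := fun x => ‖fderiv ℝ u x‖ₑ
  have hDm : Measurable D := (hu.continuous_fderiv one_ne_zero).enorm.measurable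
  have hum : Measurable fun x => ‖u x‖ₑ := hu.continuous.enorm.measurable
  set X := ∫⁻ x, ‖u x‖ₑ ^ P * w x with hX
  -- Needed to divide by a power of X at the end: u is bounded with compact support and w is locally
  -- integrable.
  have hXfin : X ≠ ⊤ := by
    obtain ⟨M, hM⟩ := hc.exists_bound_of_continuous hu.continuous
    obtain ⟨R, hR0, hR⟩ := hc.isCompact.isBounded.subset_ball_lt 0 0
    have : X ≤ ENNReal.ofReal M ^ P * ∫⁻ x in ball 0 R, w x := by
      rw [← lintegral_const_mul _ hwm, ← lintegral_indicator measurableSet_ball]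
      refine lintegral_mono fun x => ?_
      by_cases hx : x ∈ ball (0 : Eucl d) R
      · rw [indicator_of_mem hx]
        gcongr
        rw [← ofReal_norm]
        exact ENNReal.ofReal_le_ofReal (hM x)
      · have : u x = 0 := image_eq_zero_of_notMem_tsupport fun h => hx (hR h)
        simp [this, hP0]
    exact ne_top_of_le_ne_top (ENNReal.mul_ne_top
      (ENNReal.rpow_ne_top_of_nonneg hP0.le ofReal_ne_top) (hwfin 0 R hR0)) this
  have hbound : ∀ x, ‖fderiv ℝ (fun x => ‖u x‖ ^ P) x‖ₑ * ∫⁻ t in Ioi (0 : ℝ),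
      ⨍⁻ z in ball x t, w z ∂volume
      ≤ p.toNNReal * C * K * (D x * (‖u x‖ₑ ^ P * w x) ^ (1 - 1 / P)) := by
    intro x
    have h1 := enorm_fderiv_norm_rpow_le (hu.differentiable one_ne_zero) (x := x) (p := p.toNNReal)
      (by rw [← NNReal.coe_lt_coe, hPnn]; exact_mod_cast hP)
    rw [hPnn] at h1
    refine (mul_le_mul' h1 (hS x)).trans (le_of_eq ?_)
    have h2 : (‖u x‖ₑ ^ P) ^ (1 - 1 / P) = ‖u x‖ₑ ^ (P - 1) := by
      rw [← ENNReal.rpow_mul]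
      congr 1
      field_simp
    rw [ENNReal.mul_rpow_of_nonneg _ _ he.le, h2]
    ring
  have hmain : X ≤ p.toNNReal * C * K * ((∫⁻ x, D x ^ P) ^ (1 / P) * X ^ (1 - 1 / P)) := by
    calc X = ∫⁻ x, ‖‖u x‖ ^ P‖ₑ * w x := by
          simp_rw [Real.enorm_rpow_of_nonneg (norm_nonneg _) hP0.le, enorm_norm, hX]
      -- The representation is applied to |u|^p, which is C¹ because p > 1.
      _ ≤ _ := lintegral_enorm_mul_le hd (hu.norm_rpow hP)
          (hc.comp_left (g := fun y : ℝ => ‖y‖ ^ P) (by simp [hP0.ne'])) hwm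
      _ ≤ ∫⁻ x, p.toNNReal * C * K * (D x * (‖u x‖ₑ ^ P * w x) ^ (1 - 1 / P)) :=
          lintegral_mono hbound
      _ = p.toNNReal * C * K * ∫⁻ x, D x * (‖u x‖ₑ ^ P * w x) ^ (1 - 1 / P) :=
          lintegral_const_mul _ (by fun_prop)
      _ ≤ _ := by
          gcongr
          refine (ENNReal.lintegral_mul_le_Lp_mul_Lq volume hconj hDm.aemeasurable
            (g := fun x => (‖u x‖ₑ ^ P * w x) ^ (1 - 1 / P)) (by fun_prop)).trans (le_of_eq ?_)
          have e1 : (1 - 1 / P) * (P / (P - 1)) = 1 := by field_simp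
          have e2 : 1 / (P / (P - 1)) = 1 - 1 / P := by field_simp
          simp_rw [← ENNReal.rpow_mul, e1, e2, ENNReal.rpow_one, hX]
  have hle : ∫⁻ x, ‖b x * u x‖ₑ ^ P ≤ X := by
    refine lintegral_mono_ae ?_
    filter_upwards [hbw] with x hx
    rw [enorm_mul, ENNReal.mul_rpow_of_nonneg _ _ hP0.le, mul_comm]
    gcongr
  refine (ENNReal.rpow_le_rpow hle (by positivity)).trans ?_
  rcases eq_or_ne X 0 with h0 | h0
  · rw [h0, ENNReal.zero_rpow_of_pos (by positivity)]
    exact zero_le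
  have hX0 : X ^ (1 - 1 / P) ≠ 0 := by simp [h0, hXfin]
  have hX1 : X ^ (1 - 1 / P) ≠ ⊤ := ENNReal.rpow_ne_top_of_nonneg he.le hXfin
  rw [← ENNReal.mul_le_mul_iff_left hX0 hX1, ← ENNReal.rpow_add _ _ h0 hXfin]
  calc X ^ (1 / P + (1 - 1 / P)) = X := by rw [add_sub_cancel, ENNReal.rpow_one]
    _ ≤ _ := hmain
    _ = _ := by push_cast; ring

end FeffermanPhong

/-! ### Passage to Sobolev functions by cutoffs and mollification. -/

section Sobolev

open Metric Set Filter Topology ENNReal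

variable {d : ℕ}

theorem eLpNorm_le_of_ae_tendsto_of_tendsto {α E : Type*} [MeasurableSpace α] {μ : Measure α}
    [NormedAddCommGroup E] {p : ℝ≥0∞} {f : ℕ → α → E} {g : α → E} {c : ℕ → ℝ≥0∞} {C : ℝ≥0∞}
    (hf : ∀ n, AEStronglyMeasurable (f n) μ) (hfg : ∀ᵐ x ∂μ, Tendsto (f · x) atTop (𝓝 (g x)))
    (hc : ∀ n, eLpNorm (f n) p μ ≤ c n) (hC : Tendsto c atTop (𝓝 C)) : eLpNorm g p μ ≤ C :=
  (Lp.eLpNorm_lim_le_liminf_eLpNorm hf g hfg).trans <|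
    (liminf_le_liminf (Eventually.of_forall hc)).trans hC.liminf_eq.le

theorem eLpNorm_fderiv_mul_le {p : ℝ≥0∞} (hp : 1 ≤ p) {ψ u : Eucl d → ℝ} {m : ℝ}
    (hψ : ContDiff ℝ 1 ψ) (hu : ContDiff ℝ 1 u) (hψ1 : ∀ x, ‖ψ x‖ ≤ 1)
    (hψd : ∀ x, ‖fderiv ℝ ψ x‖ ≤ m) :
    eLpNorm (fderiv ℝ fun x => ψ x * u x) p volume
      ≤ eLpNorm (fderiv ℝ u) p volume + ENNReal.ofReal m * eLpNorm u p volume := by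
  have hm : 0 ≤ m := (norm_nonneg _).trans (hψd 0)
  have hg : ∀ x, ‖fderiv ℝ (fun x => ψ x * u x) x‖ ≤ ‖fderiv ℝ u x‖ + ‖(m • u) x‖ := by
    intro x
    rw [fderiv_fun_mul (hψ.differentiable one_ne_zero x) (hu.differentiable one_ne_zero x)]
    refine (norm_add_le _ _).trans ?_
    rw [norm_smul, norm_smul]
    refine add_le_add (mul_le_of_le_one_left (norm_nonneg _) (hψ1 x)) ?_
    rw [Pi.smul_apply, norm_smul, mul_comm, Real.norm_of_nonneg hm]
    gcongr
    exact hψd x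
  calc eLpNorm (fderiv ℝ fun x => ψ x * u x) p volume
      ≤ eLpNorm ((fun x => ‖fderiv ℝ u x‖) + fun x => ‖(m • u) x‖) p volume :=
        eLpNorm_mono_real hg
    _ ≤ eLpNorm (fun x => ‖fderiv ℝ u x‖) p volume + eLpNorm (fun x => ‖(m • u) x‖) p volume :=
        eLpNorm_add_le (hu.continuous_fderiv one_ne_zero).norm.aestronglyMeasurable
          (hu.continuous.const_smul m).norm.aestronglyMeasurable hp
    _ = eLpNorm (fderiv ℝ u) p volume + ENNReal.ofReal m * eLpNorm u p volume := by
        rw [eLpNorm_norm, eLpNorm_norm, eLpNorm_const_smul, Real.enorm_of_nonneg hm]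

/-- The inequality for smooth functions extends from compactly supported functions to those in the
first order Sobolev space. -/
theorem eLpNorm_mul_le_of_memLp {p : ℝ≥0∞} (hp : 1 ≤ p) {b : Eucl d → ℝ}
    (hb : AEStronglyMeasurable b volume) {A : ℝ≥0∞} (hA : A ≠ ⊤)
    (h : ∀ u : Eucl d → ℝ, ContDiff ℝ 1 u → HasCompactSupport u →
      eLpNorm (fun x => b x * u x) p volume ≤ A * eLpNorm (fderiv ℝ u) p volume)
    {u : Eucl d → ℝ} (hu : ContDiff ℝ 1 u) (hup : eLpNorm u p volume ≠ ⊤) :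
    eLpNorm (fun x => b x * u x) p volume ≤ A * eLpNorm (fderiv ℝ u) p volume := by
  let χ : ContDiffBump (0 : Eucl d) := ⟨1, 2, one_pos, one_lt_two⟩
  have hχ : ContDiff ℝ 1 χ := χ.contDiff
  have hχc : HasCompactSupport χ := χ.hasCompactSupport
  obtain ⟨M, hM⟩ := (hχc.fderiv (𝕜 := ℝ)).exists_bound_of_continuous
    (hχ.continuous_fderiv one_ne_zero)
  -- The cutoffs χ(r x) equal 1 near any given point for large n, and their gradients are O(r); the
  -- error term r M ‖u‖_p vanishes in the limit.
  set r : ℕ → ℝ := fun n => 1 / ((n : ℝ) + 1)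
  have hr : ∀ n, 0 < r n := fun n => by positivity
  have hr0 : Tendsto r atTop (𝓝 0) := tendsto_one_div_add_atTop_nhds_zero_nat
  set ψ : ℕ → Eucl d → ℝ := fun n x => χ (r n • x)
  have hψ : ∀ n, ContDiff ℝ 1 (ψ n) := fun n => hχ.comp (contDiff_const_smul _)
  have hψc : ∀ n, HasCompactSupport (ψ n) := fun n => hχc.comp_smul (hr n).ne'
  have hψd : ∀ n x, ‖fderiv ℝ (ψ n) x‖ ≤ r n * M := by
    intro n x
    have h1 : fderiv ℝ (ψ n) x = r n • fderiv ℝ χ (r n • x) := by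
      have := ((hχ.differentiable one_ne_zero (r n • x)).hasFDerivAt.comp x
        ((hasFDerivAt_id x).const_smul (r n))).fderiv
      refine this.trans ?_
      ext v
      simp
    rw [h1, norm_smul, Real.norm_of_nonneg (hr n).le]
    gcongr
    exact hM _
  have hbound : ∀ n, eLpNorm (fun x => b x * (ψ n x * u x)) p volume
      ≤ A * (eLpNorm (fderiv ℝ u) p volume
        + ENNReal.ofReal (r n * M) * eLpNorm u p volume) := by
    intro n
    refine (h _ ((hψ n).mul hu) ((hψc n).mul_right)).trans ?_
    gcongr
    exact eLpNorm_fderiv_mul_le hp (hψ n) hu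
      (fun x => (Real.norm_of_nonneg χ.nonneg).trans_le χ.le_one) (hψd n)
  refine eLpNorm_le_of_ae_tendsto_of_tendsto
    (f := fun n x => b x * (ψ n x * u x)) (fun n => hb.mul
    ((hψ n).continuous.mul hu.continuous).aestronglyMeasurable) ?_ hbound ?_
  · refine Eventually.of_forall fun x => tendsto_const_nhds.congr' ?_
    have h1 : Tendsto (fun n => r n • x) atTop (𝓝 0) := by
      simpa using hr0.smul_const x
    filter_upwards [h1 (closedBall_mem_nhds 0 one_pos)] with n hn
    rw [show ψ n x = 1 from χ.one_of_mem_closedBall hn, one_mul]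
  · have h1 : Tendsto (fun n => ENNReal.ofReal (r n * M) * eLpNorm u p volume) atTop (𝓝 0) := by
      have h2 : Tendsto (fun n => ENNReal.ofReal (r n * M)) atTop (𝓝 0) := by
        simpa using ENNReal.tendsto_ofReal (hr0.mul_const M)
      simpa using ENNReal.Tendsto.mul_const h2 (Or.inr hup)
    simpa using ENNReal.Tendsto.const_mul (tendsto_const_nhds.add h1) (Or.inr hA)

/-- Averaging against a probability density does not increase the `L_p` norm. -/
theorem eLpNorm_integral_mul_le {p : ℝ≥0∞} (hp : 1 < p) (hp' : p ≠ ⊤) {φ : Eucl d → ℝ}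
    (hφ : Continuous φ) (hφ0 : ∀ x, 0 ≤ φ x) (hφi : Integrable φ) (hφ1 : ∫ x, φ x = 1)
    {g : Eucl d → ℝ} (hg : AEStronglyMeasurable g volume) :
    eLpNorm (fun x => ∫ t, φ (x - t) * g t) p volume ≤ eLpNorm g p volume := by
  wlog hgm : StronglyMeasurable g generalizing g
  · have h1 := this (g := hg.mk g) hg.stronglyMeasurable_mk.aestronglyMeasurable
      hg.stronglyMeasurable_mk
    have h2 : (fun x => ∫ t, φ (x - t) * g t) = fun x => ∫ t, φ (x - t) * hg.mk g t := by
      ext x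
      refine integral_congr_ae ?_
      filter_upwards [hg.ae_eq_mk] with t ht
      rw [ht]
    rwa [h2, eLpNorm_congr_ae hg.ae_eq_mk]
  have hp0 : p ≠ 0 := (zero_lt_one.trans hp).ne'
  have hP : 1 < p.toReal := by
    simpa using (ENNReal.toReal_lt_toReal (by simp) hp').2 hp
  rw [eLpNorm_eq_lintegral_rpow_enorm_toReal hp0 hp', eLpNorm_eq_lintegral_rpow_enorm_toReal hp0 hp']
  set P := p.toReal
  have hconj : P.HolderConjugate (P / (P - 1)) := Real.HolderConjugate.conjExponent hP
  have hgm' : Measurable fun t => ‖g t‖ₑ := hgm.enorm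
  have hφm : Measurable fun t => ‖φ t‖ₑ := hφ.enorm.measurable
  have hmass : ∫⁻ t, ‖φ t‖ₑ = 1 := by
    have := ofReal_integral_eq_lintegral_ofReal hφi (Eventually.of_forall hφ0)
    rw [hφ1, ENNReal.ofReal_one] at this
    rw [this]
    congr 1 with t
    exact Real.enorm_of_nonneg (hφ0 t)
  have hmass' : ∀ x, ∫⁻ t, ‖φ (x - t)‖ₑ = 1 := fun x => by
    rw [lintegral_sub_left_eq_self (fun t => ‖φ t‖ₑ) x, hmass]
  -- Jensen's inequality, obtained from Hölder against the constant 1 for the probability measure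
  -- φ(x - t) dt.
  have hjensen : ∀ x, ‖∫ t, φ (x - t) * g t‖ₑ ^ P ≤ ∫⁻ t, ‖φ (x - t)‖ₑ * ‖g t‖ₑ ^ P := by
    intro x
    have hw : Measurable fun t => ‖φ (x - t)‖ₑ := hφm.comp (measurable_const.sub measurable_id)
    have h1 : ‖∫ t, φ (x - t) * g t‖ₑ
        ≤ ∫⁻ t, ‖g t‖ₑ ∂(volume.withDensity fun t => ‖φ (x - t)‖ₑ) := by
      rw [lintegral_withDensity_eq_lintegral_mul _ hw hgm']
      refine (enorm_integral_le_lintegral_enorm _).trans (le_of_eq ?_)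
      simp [enorm_mul]
    have h2 := ENNReal.lintegral_mul_le_Lp_mul_Lq
      (volume.withDensity fun t => ‖φ (x - t)‖ₑ) hconj hgm'.aemeasurable
      (g := fun _ => 1) aemeasurable_const
    simp only [Pi.mul_apply, mul_one, ENNReal.one_rpow, lintegral_const,
      withDensity_apply _ MeasurableSet.univ, Measure.restrict_univ, hmass' x] at h2
    have h3 := ENNReal.rpow_le_rpow (h1.trans h2) (by linarith : 0 ≤ P)
    rw [← ENNReal.rpow_mul, one_div_mul_cancel (by linarith), ENNReal.rpow_one,
      lintegral_withDensity_eq_lintegral_mul _ hw (hgm'.pow_const P)] at h3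
    exact h3
  refine ENNReal.rpow_le_rpow ?_ (by positivity)
  calc ∫⁻ x, ‖∫ t, φ (x - t) * g t‖ₑ ^ P
      ≤ ∫⁻ x, ∫⁻ t, ‖φ (x - t)‖ₑ * ‖g t‖ₑ ^ P := lintegral_mono hjensen
    _ = ∫⁻ t, ∫⁻ x, ‖φ (x - t)‖ₑ * ‖g t‖ₑ ^ P := by
        refine lintegral_lintegral_swap (Measurable.aemeasurable ?_)
        exact (hφm.comp (measurable_fst.sub measurable_snd)).mul
          ((hgm'.comp measurable_snd).pow_const P)
    _ = ∫⁻ t, ‖g t‖ₑ ^ P := by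
        congr 1 with t
        have hm : Measurable fun x => ‖φ (x - t)‖ₑ := hφm.comp (measurable_id.sub measurable_const)
        rw [lintegral_mul_const _ hm,
          lintegral_sub_right_eq_self (fun x => ‖φ x‖ₑ) t, hmass, one_mul]

/-- Mollification commutes with weak derivatives. -/
theorem partialD_integral_mul_eq {i : Fin d} {f g : Eucl d → ℝ} (h : HasWeakPartial i f g)
    {φ : Eucl d → ℝ} (hφ : ContDiff ℝ ∞ φ) (hφc : HasCompactSupport φ) (x : Eucl d) :
    partialD i (fun x => ∫ t, φ (x - t) * f t) x = ∫ t, φ (x - t) * g t := by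
  set L := ContinuousLinearMap.mul ℝ ℝ
  have h1 : (fun x => ∫ t, φ (x - t) * f t) = convolution f φ L volume := by
    ext x
    rw [convolution_def]
    congr 1 with t
    exact mul_comm _ _
  have hφ1 : ContDiff ℝ 1 φ := hφ.of_le (by simp)
  rw [partialD, h1, (hφc.hasFDerivAt_convolution_right L h.1 hφ1 x).fderiv,
    convolution_precompR_apply L h.1 (hφc.fderiv (𝕜 := ℝ)) (hφ1.continuous_fderiv one_ne_zero),
    convolution_def]
  have hψ : ContDiff ℝ ∞ fun t => φ (x - t) := hφ.comp (contDiff_const.sub contDiff_id)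
  have hψc : HasCompactSupport fun t => φ (x - t) :=
    hφc.comp_isClosedEmbedding (Homeomorph.subLeft x).isClosedEmbedding
  -- The test function is t ↦ φ(x - t); the sign from the inner derivative cancels the one in the
  -- definition of weak derivative.
  have h2 := h.2.2 _ hψ hψc
  have h3 : ∀ t, partialD i (fun t => φ (x - t)) t
      = -(fderiv ℝ φ (x - t) (EuclideanSpace.single i 1)) := by
    intro t
    have := ((hφ1.differentiable one_ne_zero (x - t)).hasFDerivAt.comp t
      ((hasFDerivAt_id t).const_sub x)).fderiv
    rw [partialD]
    refine (congrArg (fun T => T (EuclideanSpace.single i 1)) this).trans ?_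
    simp
  simp_rw [h3, neg_mul, integral_neg, neg_inj] at h2
  rw [← h2]
  congr 1 with t
  exact mul_comm _ _

theorem fderiv_apply_eq_sum_partialD (u : Eucl d → ℝ) (x v : Eucl d) :
    fderiv ℝ u x v = ∑ i, v i * partialD i u x := by
  conv_lhs => rw [← (EuclideanSpace.basisFun (Fin d) ℝ).sum_repr v]
  simp [partialD]

theorem norm_fderiv_le_norm_gradD (u : Eucl d → ℝ) (x : Eucl d) :
    ‖fderiv ℝ u x‖ ≤ ‖gradD u x‖ := by
  refine ContinuousLinearMap.opNorm_le_bound _ (norm_nonneg _) fun v => ?_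
  have : fderiv ℝ u x v = inner ℝ (gradD u x) v := by
    rw [fderiv_apply_eq_sum_partialD]
    simp [gradD, PiLp.inner_apply]
  rw [this]
  exact norm_inner_le_norm _ _

theorem norm_le_sum_norm_apply {ι : Type*} [Fintype ι] (v : EuclideanSpace ℝ ι) :
    ‖v‖ ≤ ∑ i, ‖v i‖ := by
  conv_lhs => rw [← (EuclideanSpace.basisFun ι ℝ).sum_repr v]
  refine (norm_sum_le _ _).trans (le_of_eq ?_)
  simp [norm_smul]

theorem eLpNorm_le_sum_of_norm_le {ι F : Type*} [NormedAddCommGroup F] {p : ℝ≥0∞} (hp : 1 ≤ p)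
    {f : Eucl d → F} {g : ι → Eucl d → ℝ} (s : Finset ι)
    (hg : ∀ i ∈ s, AEStronglyMeasurable (g i) volume)
    (h : ∀ x, ‖f x‖ ≤ ∑ i ∈ s, ‖g i x‖) :
    eLpNorm f p volume ≤ ∑ i ∈ s, eLpNorm (g i) p volume := by
  calc eLpNorm f p volume ≤ eLpNorm (∑ i ∈ s, fun x => ‖g i x‖) p volume := by
        refine eLpNorm_mono_real fun x => ?_
        simpa using h x
    _ ≤ ∑ i ∈ s, eLpNorm (fun x => ‖g i x‖) p volume :=
        eLpNorm_sum_le (fun i hi => (hg i hi).norm) hp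
    _ = _ := by simp_rw [eLpNorm_norm]

/-- The inequality for Sobolev functions. -/
theorem eLpNorm_mul_le_of_hasWeakPartial {p : ℝ≥0∞} (hp : 1 < p) (hp' : p ≠ ⊤) {b : Eucl d → ℝ}
    (hb : AEStronglyMeasurable b volume) {A : ℝ≥0∞} (hA : A ≠ ⊤)
    (h : ∀ u : Eucl d → ℝ, ContDiff ℝ 1 u → HasCompactSupport u →
      eLpNorm (fun x => b x * u x) p volume ≤ A * eLpNorm (fderiv ℝ u) p volume)
    {f : Eucl d → ℝ} {g : Fin d → Eucl d → ℝ} (hfg : ∀ i, HasWeakPartial i f (g i))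
    (hf : LocallyIntegrable f) (hfp : eLpNorm f p volume ≠ ⊤) :
    eLpNorm (fun x => b x * f x) p volume ≤ A * ∑ i, eLpNorm (g i) p volume := by
  -- The fixed ratio 2 of outer to inner radius is what gives a.e. convergence of the mollifications
  -- of a merely locally integrable function.
  let φ : ℕ → ContDiffBump (0 : Eucl d) := fun n =>
    ⟨1 / ((n : ℝ) + 1), 2 * (1 / ((n : ℝ) + 1)), by positivity,
      lt_mul_of_one_lt_left (by positivity) one_lt_two⟩
  set ψ : ℕ → Eucl d → ℝ := fun n => (φ n).normed volume
  have hψ : ∀ n, ContDiff ℝ ∞ (ψ n) := fun n => (φ n).contDiff_normed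
  have hψc : ∀ n, HasCompactSupport (ψ n) := fun n => (φ n).hasCompactSupport_normed
  set F : ℕ → Eucl d → ℝ := fun n x => ∫ t, ψ n (x - t) * f t
  have hF : ∀ n, F n = convolution f (ψ n) (ContinuousLinearMap.mul ℝ ℝ) volume := by
    intro n
    funext x
    refine integral_congr_ae (Eventually.of_forall fun t => ?_)
    exact mul_comm _ _
  have hFs : ∀ n, ContDiff ℝ 1 (F n) := fun n => by
    rw [hF]
    exact_mod_cast (hψc n).contDiff_convolution_right (n := 1) _ hf ((hψ n).of_le (by simp))
  have hjensen : ∀ n {g : Eucl d → ℝ}, AEStronglyMeasurable g volume →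
      eLpNorm (fun x => ∫ t, ψ n (x - t) * g t) p volume ≤ eLpNorm g p volume :=
    fun n g hg => eLpNorm_integral_mul_le hp hp' (φ n).continuous_normed (φ n).nonneg_normed
      (φ n).integrable_normed (φ n).integral_normed hg
  have hFd : ∀ n, eLpNorm (fderiv ℝ (F n)) p volume ≤ ∑ i, eLpNorm (g i) p volume := by
    intro n
    have hpart : ∀ i, partialD i (F n) = fun x => ∫ t, ψ n (x - t) * g i t := fun i =>
      funext fun x => partialD_integral_mul_eq (hfg i) (hψ n) (hψc n) x
    have hcont : ∀ i, Continuous (partialD i (F n)) := fun i =>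
      ((hFs n).continuous_fderiv one_ne_zero).clm_apply continuous_const
    refine (eLpNorm_le_sum_of_norm_le hp.le (g := fun i => partialD i (F n)) Finset.univ
      (fun i _ => (hcont i).aestronglyMeasurable) fun x => ?_).trans ?_
    · exact (norm_fderiv_le_norm_gradD _ _).trans (norm_le_sum_norm_apply _)
    · gcongr with i
      rw [hpart i]
      exact hjensen n (hfg i).2.1.aestronglyMeasurable
  refine eLpNorm_le_of_ae_tendsto_of_tendsto (f := fun n x => b x * F n x)
    (c := fun _ => A * ∑ i, eLpNorm (g i) p volume)
    (fun n => hb.mul (hFs n).continuous.aestronglyMeasurable) ?_ (fun n => ?_) tendsto_const_nhds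
  · have hlim : Tendsto (fun n => (φ n).rOut) atTop (𝓝 0) := by
      have := (tendsto_one_div_add_atTop_nhds_zero_nat (𝕜 := ℝ)).const_mul 2
      rwa [mul_zero] at this
    filter_upwards [ContDiffBump.ae_convolution_tendsto_right_of_locallyIntegrable hlim (K := 2)
      (Eventually.of_forall fun n => le_rfl) hf] with x hx
    refine Tendsto.const_mul _ (hx.congr fun n => ?_)
    exact convolution_lsmul_swap
  · refine (eLpNorm_mul_le_of_memLp hp.le hb hA h (hFs n) ?_).trans ?_
    · exact ne_top_of_le_ne_top hfp (hjensen n hf.aestronglyMeasurable)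
    · gcongr
      exact hFd n

end Sobolev

/-! ### Reduction to scalar coefficients and the bounded operator. -/

theorem morreyNorm_norm {d : ℕ} {F : Type*} [NormedAddCommGroup F] (q : ENNReal) (β : ℝ)
    (b : Eucl d → F) : morreyNorm q β (fun x => ‖b x‖) = morreyNorm q β b := by
  simp only [morreyNorm, avgNorm, eLpNorm_norm]

theorem MemMorrey.norm {d : ℕ} {F : Type*} [NormedAddCommGroup F] {q : ENNReal} {β : ℝ}
    {b : Eucl d → F} (hb : MemMorrey q β b) : MemMorrey q β fun x => ‖b x‖ :=
  ⟨hb.1.norm, by rw [morreyNorm_norm]; exact hb.2⟩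

/-- Lets a vector field b enter only through the scalar function |b|, which has the same Morrey
norm. -/
theorem norm_sum_mul_le {ι : Type*} [Fintype ι] (v w : EuclideanSpace ℝ ι) :
    ‖∑ i, v i * w i‖ ≤ ∑ i, ‖‖v‖ * w i‖ := by
  refine (norm_sum_le _ _).trans (Finset.sum_le_sum fun i _ => ?_)
  rw [norm_mul, norm_mul, norm_norm]
  gcongr
  exact PiLp.norm_apply_le v i

/-- Pointwise multiplication by a vector field as a linear map. -/
theorem exists_linearMap_sum_mul {d : ℕ} {p : ENNReal} {E : Type*} [AddCommGroup E] [Module ℝ E]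
    (b : Eucl d → Eucl d) (G : E →ₗ[ℝ] Lp (Eucl d) p (volume : Measure (Eucl d)))
    (hmem : ∀ U, MemLp (fun x => ∑ i, b x i * G U x i) p volume) :
    ∃ T : E →ₗ[ℝ] Lp ℝ p (volume : Measure (Eucl d)),
      ∀ U, (T U : Eucl d → ℝ) =ᵐ[volume] fun x => ∑ i, b x i * G U x i := by
  refine ⟨{ toFun := fun U => (hmem U).toLp, map_add' := fun U V => ?_, map_smul' := fun c U => ?_ },
    fun U => (hmem U).coeFn_toLp⟩
  · rw [← MemLp.toLp_add]
    refine MemLp.toLp_congr _ _ ?_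
    rw [map_add]
    filter_upwards [Lp.coeFn_add (G U) (G V)] with x hx
    simp only [hx, Pi.add_apply, PiLp.add_apply, mul_add, Finset.sum_add_distrib]
  · rw [RingHom.id_apply, ← MemLp.toLp_const_smul]
    refine MemLp.toLp_congr _ _ ?_
    rw [map_smul]
    filter_upwards [Lp.coeFn_smul c (G U)] with x hx
    simp [hx, Finset.mul_sum, mul_left_comm]

/-- The weak gradient as a linear map. -/
noncomputable def SobolevW2.gradLinear (d : ℕ) (p : ENNReal) [Fact (1 ≤ p)] :
    SobolevW2 d p →ₗ[ℝ] Lp (Eucl d) p (volume : Measure (Eucl d)) where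
  toFun := SobolevW2.grad
  map_add' _ _ := rfl
  map_smul' _ _ := rfl

theorem eLpNorm_smul_gradD_le {d : ℕ} {p : ENNReal} (hp : 1 ≤ p) {b : Eucl d → ℝ}
    (hb : AEStronglyMeasurable b volume) {A : ENNReal}
    (h : ∀ u : Eucl d → ℝ, ContDiff ℝ 1 u → HasCompactSupport u →
      eLpNorm (fun x => b x * u x) p volume ≤ A * eLpNorm (fderiv ℝ u) p volume)
    {u : Eucl d → ℝ} (hu : ContDiff ℝ ∞ u) (hc : HasCompactSupport u) :
    eLpNorm (fun x => b x • gradD u x) p volume ≤ d * A * eLpNorm (hessD u) p volume := by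
  have hD : ∀ i, ContDiff ℝ 1 (partialD i u) := fun i =>
    ((contDiff_infty_iff_fderiv.1 hu).2.of_le (by simp)).clm_apply contDiff_const
  have hDc : ∀ i, HasCompactSupport (partialD i u) := fun i => partialD_hasCompactSupport i hc
  calc eLpNorm (fun x => b x • gradD u x) p volume
      ≤ ∑ i, eLpNorm (fun x => b x * partialD i u x) p volume := by
        refine eLpNorm_le_sum_of_norm_le hp Finset.univ
          (fun i _ => hb.mul (hD i).continuous.aestronglyMeasurable) fun x => ?_
        exact norm_le_sum_norm_apply (b x • gradD u x)
    _ ≤ ∑ i : Fin d, A * eLpNorm (hessD u) p volume := by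
        gcongr with i
        refine (h _ (hD i) (hDc i)).trans ?_
        gcongr
        refine eLpNorm_mono fun x => (norm_fderiv_le_norm_gradD _ x).trans ?_
        rw [EuclideanSpace.norm_eq, EuclideanSpace.norm_eq]
        refine Real.sqrt_le_sqrt ?_
        -- The gradient of D_i u is the i-th column of the Hessian, hence no larger than its
        -- Frobenius norm.
        rw [Fintype.sum_prod_type_right]
        exact Finset.single_le_sum (f := fun j => ∑ k, ‖hessD u x (k, j)‖ ^ 2)
          (fun j _ => Finset.sum_nonneg fun k _ => sq_nonneg _) (Finset.mem_univ i)
    _ = d * A * eLpNorm (hessD u) p volume := by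
        rw [Finset.sum_const, Finset.card_univ, Fintype.card_fin, nsmul_eq_mul]
        ring

theorem SobolevW2.aestronglyMeasurable_grad {d : ℕ} {p : ENNReal} [Fact (1 ≤ p)]
    (U : SobolevW2 d p) (i : Fin d) :
    AEStronglyMeasurable (fun x => SobolevW2.grad U x i) volume :=
  (EuclideanSpace.proj i : Eucl d →L[ℝ] ℝ).continuous.comp_aestronglyMeasurable
    (Lp.aestronglyMeasurable (SobolevW2.grad U))

theorem SobolevW2.eLpNorm_sum_mul_grad_le {d : ℕ} (hd : 0 < d) {p : ENNReal} [Fact (1 ≤ p)]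
    (hp : 1 < p) (hp' : p ≠ ⊤) {b : Eucl d → Eucl d} (hb : AEStronglyMeasurable b volume)
    {A : ENNReal} (hA : A ≠ ⊤)
    (h : ∀ u : Eucl d → ℝ, ContDiff ℝ 1 u → HasCompactSupport u →
      eLpNorm (fun x => ‖b x‖ * u x) p volume ≤ A * eLpNorm (fderiv ℝ u) p volume)
    (U : SobolevW2 d p) :
    eLpNorm (fun x => ∑ i, b x i * SobolevW2.grad U x i) p volume
      ≤ d * d * A * eLpNorm (SobolevW2.hess U) p volume := by
  calc eLpNorm (fun x => ∑ i, b x i * SobolevW2.grad U x i) p volume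
      ≤ ∑ j, eLpNorm (fun x => ‖b x‖ * SobolevW2.grad U x j) p volume :=
        eLpNorm_le_sum_of_norm_le hp.le Finset.univ
          (fun j _ => hb.norm.mul (aestronglyMeasurable_grad U j)) fun x => norm_sum_mul_le _ _
    _ ≤ ∑ j : Fin d, A * ∑ i : Fin d, eLpNorm (SobolevW2.hess U) p volume := by
        gcongr with j
        refine (eLpNorm_mul_le_of_hasWeakPartial hp hp' hb.norm hA h (fun i => U.2.2 i j)
          (U.2.2 ⟨0, hd⟩ j).1 ?_).trans ?_
        · refine ne_top_of_le_ne_top (Lp.eLpNorm_ne_top (SobolevW2.grad U)) ?_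
          exact eLpNorm_mono fun x => PiLp.norm_apply_le _ _
        · gcongr with i
          exact eLpNorm_mono fun x => PiLp.norm_apply_le (SobolevW2.hess U x) (i, j)
    _ = _ := by
        simp only [Finset.sum_const, Finset.card_univ, Fintype.card_fin, nsmul_eq_mul]
        ring

theorem SobolevW2.norm_hess_le {d : ℕ} {p : ENNReal} [Fact (1 ≤ p)] (U : SobolevW2 d p) :
    ‖SobolevW2.hess U‖ ≤ ‖U‖ :=
  (norm_snd_le U.1.2).trans (norm_snd_le U.1)

/-- A bound for the first order operator gives a bounded operator on the Sobolev space. -/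
theorem SobolevW2.exists_clm {d : ℕ} {p : ENNReal} [Fact (1 ≤ p)] {b : Eucl d → Eucl d}
    (hb : AEStronglyMeasurable b volume) {A : ENNReal} (hA : A ≠ ⊤)
    (h : ∀ U : SobolevW2 d p, eLpNorm (fun x => ∑ i, b x i * SobolevW2.grad U x i) p volume
      ≤ A * eLpNorm (SobolevW2.hess U) p volume) :
    ∃ T : SobolevW2 d p →L[ℝ] Lp ℝ p (volume : Measure (Eucl d)),
      (∀ U : SobolevW2 d p,
        (T U : Eucl d → ℝ) =ᵐ[volume] fun x => ∑ i, b x i * SobolevW2.grad U x i) ∧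
      ∀ U : SobolevW2 d p, ‖T U‖ ≤ A.toReal * ‖SobolevW2.hess U‖ := by
  have hbm : ∀ i, AEStronglyMeasurable (fun x => b x i) volume := fun i =>
    (EuclideanSpace.proj i : Eucl d →L[ℝ] ℝ).continuous.comp_aestronglyMeasurable hb
  have hfin : ∀ U : SobolevW2 d p, A * eLpNorm (SobolevW2.hess U) p volume ≠ ⊤ := fun U =>
    ENNReal.mul_ne_top hA (Lp.eLpNorm_ne_top _)
  have hmem : ∀ U : SobolevW2 d p,
      MemLp (fun x => ∑ i, b x i * SobolevW2.gradLinear d p U x i) p volume := fun U =>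
    ⟨Finset.aestronglyMeasurable_fun_sum _ fun i _ => (hbm i).mul (aestronglyMeasurable_grad U i),
      (h U).trans_lt (hfin U).lt_top⟩
  obtain ⟨T, hT⟩ := exists_linearMap_sum_mul b (SobolevW2.gradLinear d p) hmem
  have hnorm : ∀ U : SobolevW2 d p, ‖T U‖ ≤ A.toReal * ‖SobolevW2.hess U‖ := by
    intro U
    rw [Lp.norm_def, Lp.norm_def, eLpNorm_congr_ae (hT U), ← ENNReal.toReal_mul]
    exact ENNReal.toReal_mono (hfin U) (h U)
  exact ⟨T.mkContinuous A.toReal fun U => (hnorm U).trans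
    (mul_le_mul_of_nonneg_left (norm_hess_le U) ENNReal.toReal_nonneg), hT, hnorm⟩

theorem corollary2p3 (d : ℕ) (hd : 2 ≤ d) (p q : ENNReal) [Fact (1 ≤ p)]
    (hp : 1 < p) (hpq : p < q) (hq : q < ⊤) :
    ∃ N : ℝ≥0,
      (∀ b : Eucl d → ℝ, MemMorrey q 1 b →
        ∀ u : Eucl d → ℝ, ContDiff ℝ ∞ u → HasCompactSupport u →
          eLpNorm (fun x => b x * u x) p volume
              ≤ N * morreyNorm q 1 b * eLpNorm (gradD u) p volume ∧
          eLpNorm (fun x => b x • gradD u x) p volume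
              ≤ N * morreyNorm q 1 b * eLpNorm (hessD u) p volume) ∧
      (∀ b : Eucl d → Eucl d, MemMorrey q 1 b →
        ∃ T : SobolevW2 d p →L[ℝ] Lp ℝ p (volume : Measure (Eucl d)),
          (∀ U : SobolevW2 d p,
            (T U : Eucl d → ℝ) =ᵐ[volume] fun x => ∑ i, b x i * SobolevW2.grad U x i) ∧
          ∀ U : SobolevW2 d p,
            ‖T U‖ ≤ N * (morreyNorm q 1 b).toReal * ‖SobolevW2.hess U‖) := by
  have hd0 : d ≠ 0 := by omega
  have hp1 : 1 ≤ p := hp.le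
  have hp' : p ≠ ⊤ := (hpq.trans hq).ne
  obtain ⟨N, hN⟩ := exists_eLpNorm_mul_le hd0 hp hpq hq
  have hdR : (1 : ENNReal) ≤ d := by exact_mod_cast Nat.one_le_iff_ne_zero.2 hd0
  -- The operator bound loses d twice, for the components of Du and for their weak derivatives; the
  -- bounds for smooth u lose less.
  refine ⟨d * d * N, fun b hb u hu hc => ⟨?_, ?_⟩, fun b hb => ?_⟩
  · have hu1 : ContDiff ℝ 1 u := hu.of_le (by simp)
    calc eLpNorm (fun x => b x * u x) p volume
        ≤ N * morreyNorm q 1 b * eLpNorm (fderiv ℝ u) p volume := hN b hb u hu1 hc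
      _ ≤ N * morreyNorm q 1 b * eLpNorm (gradD u) p volume := by
          gcongr
          exact eLpNorm_mono fun x => norm_fderiv_le_norm_gradD u x
      _ ≤ _ := by
          push_cast
          gcongr
          exact le_mul_of_one_le_left' (one_le_mul hdR hdR)
  · refine (eLpNorm_smul_gradD_le hp1 hb.1 (hN b hb) hu hc).trans ?_
    rw [← mul_assoc]
    push_cast
    gcongr
    exact le_mul_of_one_le_left' hdR
  · have hA : N * morreyNorm q 1 b ≠ ⊤ := ENNReal.mul_ne_top (by simp) hb.2.ne
    have hbd := SobolevW2.eLpNorm_sum_mul_grad_le (Nat.pos_of_ne_zero hd0) hp hp' hb.1 hA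
      fun u hu hc => by simpa only [morreyNorm_norm] using hN _ hb.norm u hu hc
    have hA' : d * d * (N * morreyNorm q 1 b) ≠ ⊤ := ENNReal.mul_ne_top (by finiteness) hA
    obtain ⟨T, hT, hT'⟩ := SobolevW2.exists_clm hb.1 hA' hbd
    refine ⟨T, hT, fun U => (hT' U).trans (le_of_eq ?_)⟩
    simp [ENNReal.toReal_mul, mul_assoc]
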